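/- Let $\mathcal A$ be an abelian category with torsion pairs $(\mathcal T_1,\mathcal F_1)$ and $(\mathcal T_2,\mathcal F_2)$. For $i=1,2$ and $X\in\mathcal A$ let $0\to t_i(X)\to X\to f_i(X)\to 0$ be the short exact sequence with $t_i(X)\in\mathcal T_i$ and $f_i(X)\in\mathcal F_i$; this defines functors $t_i\colon\mathcal A\to\mathcal T_i$ and $f_i\colon\mathcal A\to\mathcal F_i$. Set $\mathcal C_{12}:=\mathcal T_1\cap\mathcal F_2$. The full subcategories $\mathcal T_1$, $\mathcal F_2$, $\mathcal C_{12}$ carry as conflations the short exact sequences of $\mathcal A$ with all terms in the subcategory; $\operatorname{proj}$ and $\operatorname{inj}$ denote their projective and injective objects with respect to these conflations. For an object $P$, $\operatorname{add}P$ denotes the direct summands of finite direct sums of copies of $P$. For an additive category $\mathcal B$, $\operatorname{mod}\mathcal B$ denotes the category of finitely presented contravariant additive functors from $\mathcal B$ to abelian groups. Then: (a) $\mathcal C_{12}$ is closed under extensions in $\mathcal A$ and idempotent complete, and its conflations form an exact structure in the sense of Quillen. (b) $\mathcal C_{12}$ is additive and has kernels and cokernels, i.e. it is preabelian. For $f\colon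 X\to Y$ in $\mathcal C_{12}$ the composition $t_1(\ker f)\to\ker f\to X$ is a kernel of $f$ in $\mathcal C_{12}$, and $Y\to\operatorname{coker}f\to f_2(\operatorname{coker}f)$ is a cokernel of $f$ in $\mathcal C_{12}$, where $\ker f$ and $\operatorname{coker} f$ are taken in $\mathcal A$. The categories $\operatorname{mod}\mathcal C_{12}$ and $\operatorname{mod}\mathcal C_{12}^{\mathrm{op}}$ are abelian and have global dimension at most $2$. (c) Suppose that $\mathcal T_1$ has enough projectives and $\mathcal F_2$ has enough injectives. Then $\mathcal C_{12}$ has enough projectives and enough injectives. The projectives of $\mathcal C_{12}$ are exactly the direct summands of the objects $f_2(P)$ with $P\in\operatorname{proj}\mathcal T_1$, and every object $X$ of $\mathcal C_{12}$ admits a deflation $f_2(P)\to X$ with such a $P$. The injectives of $\mathcal C_{12}$ are exactly the direct summands of the objects $t_1(I)$ with $I\in\operatorname{inj}\mathcal F_2$, and every object $X$ of $\mathcal C_{12}$ admits an inflation $X\to t_1(I)$ with such an $I$. (d) If, in addition to the hypotheses of (c), $\operatorname{Ext}^1_{\mathcal C_{12}}(X,Y)=0\Leftrightarrow\operatorname{Ext}^1_{\mathcal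 C_{12}}(Y,X)=0$ for all $X,Y\in\mathcal C_{12}$, then $\mathcal C_{12}$ is a Frobenius category. Moreover, this equivalence of $\operatorname{Ext}^1$-vanishing holds whenever $\mathcal A$ is linear over a field $k$ and either its bounded derived category $D^b(\mathcal A)$ is $2$-Calabi--Yau over $k$, or $\mathcal A$ is Frobenius and its stable category $\underline{\mathcal A}$ is $2$-Calabi--Yau over $k$. (e) Suppose, in addition to all the hypotheses of (c) and (d), that $\operatorname{proj}\mathcal T_1=\operatorname{add}P$ and $\operatorname{inj}\mathcal F_2=\operatorname{add}I$. Then $\operatorname{proj}\mathcal C_{12}=\operatorname{add}f_2(P)=\operatorname{add}t_1(I)$. If moreover the ring $\Pi_{12}:=\operatorname{End}_{\mathcal C_{12}}(f_2(P))$ is two-sided noetherian, then $\Pi_{12}$ is Iwanaga--Gorenstein of virtual dimension at most $2$ (i.e. it has injective dimension at most $2$ as a left and as a right module over itself), and $\operatorname{Hom}_{\mathcal C_{12}}(f_2(P),-)$ is an exact equivalence (an equivalence that preserves and reflects conflations) from $\mathcal C_{12}$ to the category $\operatorname{GP}(\Pi_{12})$ of finitely generated right $\Pi_{12}$-modules $M$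 with $\operatorname{Ext}^i_{\Pi_{12}}(M,\Pi_{12})=0$ for all $i>0$, whose conflations are the short exact sequences of modules with all terms in $\operatorname{GP}(\Pi_{12})$. (f) Suppose that $\operatorname{proj}\mathcal T_1=\operatorname{add}P$ and $\operatorname{inj}\mathcal F_2=\operatorname{add}I$. The functor $f_2$ induces a ring homomorphism $\varphi_2\colon\operatorname{End}_{\mathcal T_1}(P)\to\Pi_{12}=\operatorname{End}_{\mathcal C_{12}}(f_2(P))$, whose kernel consists of the endomorphisms of $P$ that factor through $t_2(P)$. The functor $t_1$ induces a ring homomorphism $\tau_1\colon\operatorname{End}_{\mathcal F_2}(I)\to\operatorname{End}_{\mathcal C_{12}}(t_1(I))$, whose kernel consists of the endomorphisms of $I$ that factor through $f_1(I)$. If $\mathcal T_2\subseteq\mathcal T_1$, both ring homomorphisms are surjective. For every isomorphism $t_1(I)\cong f_2(P)$, the ring homomorphism $\operatorname{End}_{\mathcal F_2}(I)\to\Pi_{12}$ obtained from $\tau_1$ by conjugation has the same kernel, and is surjective if $\mathcal T_2\subseteq\mathcal T_1$. -/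

import Mathlib

open CategoryTheory Limits ZeroObject

universe w w' v u

noncomputable section

namespace TorsionFrob

/-! ### Exact categories -/

section Exact

variable {E : Type u} [Category.{v} E] [Preadditive E]

/-- `i` is an inflation (admissible monomorphism) for the class `c` of conflations. -/
def IsInflation (c : ObjectProperty (ShortComplex E)) {X Y : E} (i : X ⟶ Y) : Prop :=
  ∃ (Z : E) (p : Y ⟶ Z) (w : i ≫ p = 0), c (ShortComplex.mk i p w)

/-- `p` is a deflation (admissible epimorphism) for the class `c` of conflations. -/
def IsDeflation (c : ObjectProperty (ShortComplex E)) {Y Z : E} (p : Y ⟶ Z) : Prop :=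
  ∃ (X : E) (i : X ⟶ Y) (w : i ≫ p = 0), c (ShortComplex.mk i p w)

/-- Quillen's axioms: the class `c` of conflations is an exact structure on `E`. -/
structure IsExactStructure (c : ObjectProperty (ShortComplex E)) : Prop where
  iso_closed : c.IsClosedUnderIsomorphisms
  kernel_cokernel : ∀ S : ShortComplex E, c S →
    Nonempty (IsLimit (KernelFork.ofι S.f S.zero)) ∧
      Nonempty (IsColimit (CokernelCofork.ofπ S.g S.zero))
  id_inflation : ∀ X : E, IsInflation c (𝟙 X)
  id_deflation : ∀ X : E, IsDeflation c (𝟙 X)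
  comp_inflation : ∀ {X Y Z : E} (i : X ⟶ Y) (j : Y ⟶ Z),
    IsInflation c i → IsInflation c j → IsInflation c (i ≫ j)
  comp_deflation : ∀ {X Y Z : E} (p : X ⟶ Y) (q : Y ⟶ Z),
    IsDeflation c p → IsDeflation c q → IsDeflation c (p ≫ q)
  pushout_inflation : ∀ {X Y X' : E} (i : X ⟶ Y) (a : X ⟶ X'), IsInflation c i →
    ∃ (Y' : E) (b : Y ⟶ Y') (i' : X' ⟶ Y'), IsPushout i a b i' ∧ IsInflation c i'
  pullback_deflation : ∀ {Y Z Z' : E} (p : Y ⟶ Z) (a : Z' ⟶ Z), IsDeflation c p →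
    ∃ (Y' : E) (b : Y' ⟶ Y) (p' : Y' ⟶ Z'), IsPullback b p' p a ∧ IsDeflation c p'

/-- `P` is projective in the exact category `(E, c)`. -/
def IsProj (c : ObjectProperty (ShortComplex E)) : ObjectProperty E := fun P =>
  ∀ S : ShortComplex E, c S → ∀ a : P ⟶ S.X₃, ∃ b : P ⟶ S.X₂, b ≫ S.g = a

/-- `I` is injective in the exact category `(E, c)`. -/
def IsInj (c : ObjectProperty (ShortComplex E)) : ObjectProperty E := fun I =>
  ∀ S : ShortComplex E, c S → ∀ a : S.X₁ ⟶ I, ∃ b : S.X₂ ⟶ I, S.f ≫ b = a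

/-- The exact category `(E, c)` has enough projectives. -/
def HasEnoughProj (c : ObjectProperty (ShortComplex E)) : Prop :=
  ∀ X : E, ∃ (P : E) (p : P ⟶ X), IsProj c P ∧ IsDeflation c p

/-- The exact category `(E, c)` has enough injectives. -/
def HasEnoughInj (c : ObjectProperty (ShortComplex E)) : Prop :=
  ∀ X : E, ∃ (I : E) (i : X ⟶ I), IsInj c I ∧ IsInflation c i

/-- Frobenius categories: exact categories with enough projectives and enough injectives, in
which the projective and the injective objects coincide. -/
def IsFrobenius (c : ObjectProperty (ShortComplex E)) : Prop :=
  IsExactStructure c ∧ HasEnoughProj c ∧ HasEnoughInj c ∧ ∀ X : E, IsProj c X ↔ IsInj c X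

/-- `Ext¹(X, Y) = 0` in the exact category `(E, c)`: every conflation `Y ⟶ M ⟶ X` splits. -/
def ExtOneVanishes (c : ObjectProperty (ShortComplex E)) (X Y : E) : Prop :=
  ∀ (M : E) (i : Y ⟶ M) (p : M ⟶ X) (w : i ≫ p = 0), c (ShortComplex.mk i p w) →
    Nonempty (ShortComplex.mk i p w).Splitting

/-- Vanishing of `Ext¹` is symmetric in the exact category `(E, c)`. -/
def ExtOneSymmetric (c : ObjectProperty (ShortComplex E)) : Prop :=
  ∀ X Y : E, ExtOneVanishes c X Y ↔ ExtOneVanishes c Y X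

/-- `add P`: the direct summands of finite direct sums of copies of `P`. -/
def addClosure (P : E) : ObjectProperty E := fun X =>
  ∃ (n : ℕ) (B : Bicone (fun _ : Fin n => P)), Nonempty B.IsBilimit ∧ Nonempty (Retract X B.pt)

/-- An exact equivalence: an equivalence that preserves and reflects conflations. -/
def IsExactEquivalence {E' : Type w} [Category.{w'} E'] [Preadditive E']
    (c : ObjectProperty (ShortComplex E)) (c' : ObjectProperty (ShortComplex E'))
    (G : E ⥤ E') [G.PreservesZeroMorphisms] : Prop :=
  G.IsEquivalence ∧ ∀ S : ShortComplex E, c S ↔ c' (S.map G)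

/-- The ring homomorphism on endomorphism rings induced by an additive functor. -/
def endRingHom {E' : Type w} [Category.{w'} E'] [Preadditive E'] (G : E ⥤ E') [G.Additive]
    (X : E) : End X →+* End (G.obj X) where
  __ := G.mapEnd X
  map_zero' := G.map_zero X X
  map_add' _ _ := G.map_add

/-- Transport of endomorphisms along an isomorphism. -/
def endConj {X Y : E} (e : X ≅ Y) : End X →+* End Y where
  toFun a := e.inv ≫ (show X ⟶ X from a) ≫ e.hom
  map_one' := by
    change e.inv ≫ 𝟙 X ≫ e.hom = 𝟙 Y
    rw [Category.id_comp, e.inv_hom_id]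
  map_mul' a b := by
    have h : ∀ a b : X ⟶ X,
        e.inv ≫ (b ≫ a) ≫ e.hom = (e.inv ≫ b ≫ e.hom) ≫ e.inv ≫ a ≫ e.hom := by
      intro a b
      simp
    exact h a b
  map_zero' := by
    have h : e.inv ≫ (0 : X ⟶ X) ≫ e.hom = 0 := by simp
    exact h
  map_add' a b := by
    have h : ∀ a b : X ⟶ X, e.inv ≫ (a + b) ≫ e.hom = e.inv ≫ a ≫ e.hom + e.inv ≫ b ≫ e.hom := by
      intro a b
      simp
    exact h a b

/-- Finitely presented contravariant additive functors from `E` to abelian groups: the cokernels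
of maps between representable functors. -/
def IsFinPres : ObjectProperty (Eᵒᵖ ⥤ AddCommGrpCat.{v}) := fun F =>
  F.Additive ∧ ∃ (X Y : E) (f : X ⟶ Y) (p : preadditiveYoneda.obj Y ⟶ F)
    (w : preadditiveYoneda.map f ≫ p = 0), Nonempty (IsColimit (CokernelCofork.ofπ p w))

variable (E) in
/-- The category `mod E` of finitely presented contravariant additive functors. -/
abbrev ModCat := (IsFinPres (E := E)).FullSubcategory

variable (E) in
/-- The preadditive category `E` is abelian and has global dimension at most `n`. -/
def IsAbelianOfGlobalDimLE (n : ℕ) : Prop :=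
  ∃ a : Abelian E, a.toPreadditive = ‹Preadditive E› ∧ ∀ X : E, HasProjectiveDimensionLE X n

end Exact

/-- The conflations of a full subcategory `P` of an abelian category: the short exact sequences
with all terms in `P`. -/
def confl {A : Type u} [Category.{v} A] [Abelian A] (P : ObjectProperty A) :
    ObjectProperty (ShortComplex P.FullSubcategory) := fun S =>
  (S.map P.ι).ShortExact

/-! ### Iwanaga-Gorenstein rings -/

section Gorenstein

/-- `R` is noetherian on both sides. -/
def IsTwoSidedNoetherian (R : Type v) [Ring R] : Prop :=
  IsNoetherianRing R ∧ IsNoetherianRing Rᵐᵒᵖ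

/-- Iwanaga-Gorenstein rings. -/
def IsIwanagaGorenstein (R : Type v) [Ring R] : Prop :=
  IsTwoSidedNoetherian R ∧
    (∃ n : ℕ, HasInjectiveDimensionLE (ModuleCat.of.{v} R R) n) ∧
    ∃ n : ℕ, HasInjectiveDimensionLE (ModuleCat.of.{v} Rᵐᵒᵖ Rᵐᵒᵖ) n

/-- The virtual dimension of `R` is at most `n`: the injective dimensions of `R` as a left and as
a right module over itself are at most `n`. -/
def VirDimLE (R : Type v) [Ring R] (n : ℕ) : Prop :=
  HasInjectiveDimensionLE (ModuleCat.of.{v} R R) n ∧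
    HasInjectiveDimensionLE (ModuleCat.of.{v} Rᵐᵒᵖ Rᵐᵒᵖ) n

/-- Gorenstein-projective left `R`-modules: the finitely generated modules `M` such that
`Extⁱ(M, R) = 0` for all `i > 0`. -/
def GP (R : Type v) [Ring R] : ObjectProperty (ModuleCat.{v} R) := fun M =>
  Module.Finite R M ∧ ∀ i : ℕ, 0 < i → Subsingleton (Abelian.Ext M (ModuleCat.of.{v} R R) i)

end Gorenstein

/-! ### Torsion pairs -/

/-- A torsion pair in an abelian category. -/
structure TorsionPair (A : Type u) [Category.{v} A] [Abelian A] where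
  /-- the torsion class -/
  tors : ObjectProperty A
  /-- the torsion-free class -/
  free : ObjectProperty A
  tors_iso : tors.IsClosedUnderIsomorphisms
  free_iso : free.IsClosedUnderIsomorphisms
  hom_eq_zero : ∀ {X Y : A}, tors X → free Y → ∀ a : X ⟶ Y, a = 0
  exists_ses : ∀ X : A, ∃ (T F : A) (i : T ⟶ X) (p : X ⟶ F) (w : i ≫ p = 0),
    tors T ∧ free F ∧ (ShortComplex.mk i p w).ShortExact

namespace TorsionPair

variable {A : Type u} [Category.{v} A] [Abelian A] (τ : TorsionPair A)

/-- The torsion part `t X`. -/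
def t (X : A) : A := (τ.exists_ses X).choose

/-- The torsion-free part `f X`. -/
def f (X : A) : A := (τ.exists_ses X).choose_spec.choose

/-- The inclusion `t X ⟶ X`. -/
def incl (X : A) : τ.t X ⟶ X := (τ.exists_ses X).choose_spec.choose_spec.choose

/-- The projection `X ⟶ f X`. -/
def proj (X : A) : X ⟶ τ.f X := (τ.exists_ses X).choose_spec.choose_spec.choose_spec.choose

lemma incl_proj (X : A) : τ.incl X ≫ τ.proj X = 0 :=
  (τ.exists_ses X).choose_spec.choose_spec.choose_spec.choose_spec.choose

lemma tors_t (X : A) : τ.tors (τ.t X) :=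
  (τ.exists_ses X).choose_spec.choose_spec.choose_spec.choose_spec.choose_spec.1

lemma free_f (X : A) : τ.free (τ.f X) :=
  (τ.exists_ses X).choose_spec.choose_spec.choose_spec.choose_spec.choose_spec.2.1

lemma ses (X : A) : (ShortComplex.mk (τ.incl X) (τ.proj X) (τ.incl_proj X)).ShortExact :=
  (τ.exists_ses X).choose_spec.choose_spec.choose_spec.choose_spec.choose_spec.2.2

instance (X : A) : Mono (τ.incl X) := (τ.ses X).mono_f

instance (X : A) : Epi (τ.proj X) := (τ.ses X).epi_g

lemma tors_of_epi {X Y : A} (hX : τ.tors X) (p : X ⟶ Y) [Epi p] : τ.tors Y := by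
  have h : p ≫ τ.proj Y = 0 := τ.hom_eq_zero hX (τ.free_f Y) _
  have h0 : τ.proj Y = 0 := by rwa [← cancel_epi p, comp_zero]
  have : Epi (τ.incl Y) := ((τ.ses Y).exact.epi_f_iff).2 h0
  have : IsIso (τ.incl Y) := isIso_of_mono_of_epi _
  have := τ.tors_iso
  exact τ.tors.prop_of_iso (asIso (τ.incl Y)) (τ.tors_t Y)

lemma free_of_mono {X Y : A} (hY : τ.free Y) (i : X ⟶ Y) [Mono i] : τ.free X := by
  have h : τ.incl X ≫ i = 0 := τ.hom_eq_zero (τ.tors_t X) hY _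
  have h0 : τ.incl X = 0 := by rwa [← cancel_mono i, zero_comp]
  have : Mono (τ.proj X) := ((τ.ses X).exact.mono_g_iff).2 h0
  have : IsIso (τ.proj X) := isIso_of_mono_of_epi _
  have := τ.free_iso
  exact τ.free.prop_of_iso (asIso (τ.proj X)).symm (τ.free_f X)

lemma exists_fMap {X Y : A} (a : X ⟶ Y) : ∃ b : τ.f X ⟶ τ.f Y, τ.proj X ≫ b = a ≫ τ.proj Y :=
  ⟨(τ.ses X).exact.desc (a ≫ τ.proj Y) (τ.hom_eq_zero (τ.tors_t X) (τ.free_f Y) _),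
    (τ.ses X).exact.g_desc _ _⟩

lemma exists_tMap {X Y : A} (a : X ⟶ Y) : ∃ b : τ.t X ⟶ τ.t Y, b ≫ τ.incl Y = τ.incl X ≫ a :=
  ⟨(τ.ses Y).exact.lift (τ.incl X ≫ a) (τ.hom_eq_zero (τ.tors_t X) (τ.free_f Y) _),
    (τ.ses Y).exact.lift_f _ _⟩

/-- The functor `X ↦ f X`. -/
def fFunctor : A ⥤ A where
  obj := τ.f
  map a := (τ.exists_fMap a).choose
  map_id X := by
    rw [← cancel_epi (τ.proj X), (τ.exists_fMap (𝟙 X)).choose_spec, Category.id_comp,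
      Category.comp_id]
  map_comp {X Y Z} a b := by
    rw [← cancel_epi (τ.proj X), (τ.exists_fMap (a ≫ b)).choose_spec,
      ← Category.assoc (τ.proj X), (τ.exists_fMap a).choose_spec, Category.assoc, Category.assoc,
      (τ.exists_fMap b).choose_spec]

/-- The functor `X ↦ t X`. -/
def tFunctor : A ⥤ A where
  obj := τ.t
  map a := (τ.exists_tMap a).choose
  map_id X := by
    rw [← cancel_mono (τ.incl X), (τ.exists_tMap (𝟙 X)).choose_spec, Category.id_comp,
      Category.comp_id]
  map_comp {X Y Z} a b := by
    rw [← cancel_mono (τ.incl Z), (τ.exists_tMap (a ≫ b)).choose_spec, Category.assoc,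
      (τ.exists_tMap b).choose_spec, ← Category.assoc, ← Category.assoc,
      (τ.exists_tMap a).choose_spec]

lemma proj_fFunctor_map {X Y : A} (a : X ⟶ Y) :
    τ.proj X ≫ τ.fFunctor.map a = a ≫ τ.proj Y := (τ.exists_fMap a).choose_spec

lemma tFunctor_map_incl {X Y : A} (a : X ⟶ Y) :
    τ.tFunctor.map a ≫ τ.incl Y = τ.incl X ≫ a := (τ.exists_tMap a).choose_spec

instance : τ.fFunctor.Additive where
  map_add {X Y a b} := by
    refine (cancel_epi (τ.proj X)).1 ?_
    have h := Preadditive.comp_add _ _ _ (τ.proj X) (τ.fFunctor.map a) (τ.fFunctor.map b)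
    exact (τ.proj_fFunctor_map (a + b)).trans ((Preadditive.add_comp _ _ _ a b (τ.proj Y)).trans
      ((congrArg₂ (· + ·) (τ.proj_fFunctor_map a) (τ.proj_fFunctor_map b)).symm.trans h.symm))

instance : τ.tFunctor.Additive where
  map_add {X Y a b} := by
    refine (cancel_mono (τ.incl Y)).1 ?_
    have h := Preadditive.add_comp _ _ _ (τ.tFunctor.map a) (τ.tFunctor.map b) (τ.incl Y)
    exact (τ.tFunctor_map_incl (a + b)).trans ((Preadditive.comp_add _ _ _ (τ.incl X) a b).trans
      ((congrArg₂ (· + ·) (τ.tFunctor_map_incl a) (τ.tFunctor_map_incl b)).symm.trans h.symm))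

end TorsionPair

section Core

variable {A : Type u} [Category.{v} A] [Abelian A] (τ₁ τ₂ : TorsionPair A)

/-- The intersection `C₁₂ = T₁ ∩ F₂`. -/
def core : ObjectProperty A := τ₁.tors ⊓ τ₂.free

lemma core_f {X : A} (hX : τ₁.tors X) : core τ₁ τ₂ (τ₂.f X) :=
  ⟨τ₁.tors_of_epi hX (τ₂.proj X), τ₂.free_f X⟩

lemma core_t {X : A} (hX : τ₂.free X) : core τ₁ τ₂ (τ₁.t X) :=
  ⟨τ₁.tors_t X, τ₂.free_of_mono hX (τ₁.incl X)⟩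

/-- The functor `f₂ : T₁ ⥤ C₁₂`. -/
def fCore : τ₁.tors.FullSubcategory ⥤ (core τ₁ τ₂).FullSubcategory :=
  (core τ₁ τ₂).lift (τ₁.tors.ι ⋙ τ₂.fFunctor)
    (fun X => core_f τ₁ τ₂ X.property)

/-- The functor `t₁ : F₂ ⥤ C₁₂`. -/
def tCore : τ₂.free.FullSubcategory ⥤ (core τ₁ τ₂).FullSubcategory :=
  (core τ₁ τ₂).lift (τ₂.free.ι ⋙ τ₁.tFunctor)
    (fun X => core_t τ₁ τ₂ X.property)

instance : (fCore τ₁ τ₂).Additive where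
  map_add {_ _ a b} := ObjectProperty.hom_ext _ (τ₂.fFunctor.map_add (f := a.hom) (g := b.hom))

instance : (tCore τ₁ τ₂).Additive where
  map_add {_ _ a b} := ObjectProperty.hom_ext _ (τ₁.tFunctor.map_add (f := a.hom) (g := b.hom))

end Core

/-! ### 2-Calabi-Yau categories -/

/-- A `k`-linear category `D` with an endofunctor `S₂` (the square of the suspension) is
2-Calabi-Yau: it is Hom-finite and there are isomorphisms `Hom(X, Y) ≅ D Hom(Y, S₂ X)` that are
natural in `X` and `Y`. -/
def IsTwoCalabiYau (k : Type w) [Field k] (D : Type u) [Category.{v} D] [Preadditive D]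
    [Linear k D] (S₂ : D ⥤ D) : Prop :=
  (∀ X Y : D, Module.Finite k (X ⟶ Y)) ∧
    ∃ e : ∀ X Y : D, (X ⟶ Y) ≃ₗ[k] Module.Dual k (Y ⟶ S₂.obj X),
      ∀ {X X' Y Y' : D} (a : X' ⟶ X) (h : X ⟶ Y) (b : Y ⟶ Y') (g : Y' ⟶ S₂.obj X'),
        e X' Y' (a ≫ h ≫ b) g = e X Y h (b ≫ g ≫ S₂.map a)

/-- The bounded derived category of `A` is 2-Calabi-Yau over `k`. -/
def DerivedIsTwoCalabiYau (k : Type w) [Field k] (A : Type u) [Category.{v} A] [Abelian A]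
    [Linear k A] [HasDerivedCategory.{w'} A] : Prop :=
  IsTwoCalabiYau k (DerivedCategory.TStructure.t (C := A)).bounded.FullSubcategory
    (shiftFunctor _ (2 : ℤ))

section Stable

variable (A : Type u) [Category.{v} A] [Abelian A]

/-- Two morphisms are identified if their difference factors through an injective object. -/
def stableRel : HomRel A := fun X Y a b =>
  ∃ (I : A) (p : X ⟶ I) (q : I ⟶ Y), Injective I ∧ a - b = p ≫ q

variable {A} in
lemma stableRel_refl {X Y : A} (a : X ⟶ Y) : stableRel A a a :=
  ⟨0, 0, 0, inferInstance, by simp⟩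

variable {A} in
lemma stableRel_add {X Y : A} {a b a' b' : X ⟶ Y} (h : stableRel A a b)
    (h' : stableRel A a' b') : stableRel A (a + a') (b + b') := by
  obtain ⟨I, p, q, hI, e⟩ := h
  obtain ⟨I', p', q', hI', e'⟩ := h'
  refine ⟨I ⊞ I', biprod.lift p p', biprod.desc q q', inferInstance, ?_⟩
  rw [biprod.lift_desc, ← e, ← e']
  abel

instance : Congruence (stableRel A) where
  equivalence :=
    { refl := fun a => ⟨0, 0, 0, inferInstance, by simp⟩
      symm := by
        rintro a b ⟨I, p, q, hI, e⟩
        exact ⟨I, -p, q, hI, by rw [Preadditive.neg_comp, ← e]; abel⟩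
      trans := by
        intro a b c h h'
        obtain ⟨I, p, q, hI, e⟩ := stableRel_add h h'
        exact ⟨I, p, q, hI, by rw [← e]; abel⟩ }
  comp_left := by
    rintro X Y Z a b b' ⟨I, p, q, hI, e⟩
    exact ⟨I, a ≫ p, q, hI, by rw [← Preadditive.comp_sub, e, Category.assoc]⟩
  comp_right := by
    rintro X Y Z a a' b ⟨I, p, q, hI, e⟩
    exact ⟨I, p, q ≫ b, hI, by rw [← Preadditive.sub_comp, e, Category.assoc]⟩

/-- The stable category of an abelian category, modulo injective objects. It is used for Frobenius
categories only, where the injective objects are the projective ones. -/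
abbrev Stable := CategoryTheory.Quotient (stableRel A)

instance : Preadditive (Stable A) :=
  CategoryTheory.Quotient.preadditive _ (fun _ _ _ _ _ _ h h' => stableRel_add h h')

instance : (CategoryTheory.Quotient.functor (stableRel A)).Additive :=
  CategoryTheory.Quotient.functor_additive _ (fun _ _ _ _ _ _ h h' => stableRel_add h h')

instance (k : Type w) [Field k] [Linear k A] : Linear k (Stable A) :=
  CategoryTheory.Quotient.linear k _ (by
    rintro c X Y a b ⟨I, p, q, hI, e⟩
    exact ⟨I, c • p, q, hI, by rw [Linear.smul_comp, ← e, smul_sub]⟩)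

variable {A} [EnoughInjectives A]

/-- The cosyzygy `Σ X`, the cokernel of the embedding of `X` into an injective object. -/
abbrev cosyz (X : A) : A := cokernel (Injective.ι X)

lemma exists_cosyzMap {X Y : A} (a : X ⟶ Y) :
    ∃ (j : Injective.under X ⟶ Injective.under Y) (b : cosyz X ⟶ cosyz Y),
      Injective.ι X ≫ j = a ≫ Injective.ι Y ∧
        cokernel.π (Injective.ι X) ≫ b = j ≫ cokernel.π (Injective.ι Y) := by
  refine ⟨Injective.factorThru (a ≫ Injective.ι Y) (Injective.ι X),
    cokernel.desc _ (Injective.factorThru (a ≫ Injective.ι Y) (Injective.ι X) ≫ cokernel.π _) ?_,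
    Injective.comp_factorThru _ _, cokernel.π_desc _ _ _⟩
  rw [← Category.assoc, Injective.comp_factorThru, Category.assoc, cokernel.condition, comp_zero]

/-- Morphisms between cosyzygies induced by stably equal morphisms are stably equal. -/
lemma cosyz_stable {X Y : A} {a a' : X ⟶ Y} (h : stableRel A a a')
    {j j' : Injective.under X ⟶ Injective.under Y} {b b' : cosyz X ⟶ cosyz Y}
    (hj : Injective.ι X ≫ j = a ≫ Injective.ι Y)
    (hj' : Injective.ι X ≫ j' = a' ≫ Injective.ι Y)
    (hb : cokernel.π (Injective.ι X) ≫ b = j ≫ cokernel.π (Injective.ι Y))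
    (hb' : cokernel.π (Injective.ι X) ≫ b' = j' ≫ cokernel.π (Injective.ι Y)) :
    stableRel A b b' := by
  obtain ⟨I, p, q, hI, e⟩ := h
  let p' := Injective.factorThru p (Injective.ι X)
  have hp' : Injective.ι X ≫ p' = p := Injective.comp_factorThru _ _
  have hz : Injective.ι X ≫ (j - j' - p' ≫ q ≫ Injective.ι Y) = 0 := by
    rw [Preadditive.comp_sub, Preadditive.comp_sub, hj, hj', ← Category.assoc _ p', hp',
      ← Preadditive.sub_comp, e, Category.assoc, sub_self]
  refine ⟨Injective.under Y, cokernel.desc _ _ hz, cokernel.π (Injective.ι Y), inferInstance, ?_⟩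
  rw [← cancel_epi (cokernel.π (Injective.ι X)), Preadditive.comp_sub, hb, hb',
    cokernel.π_desc_assoc, Preadditive.sub_comp, Preadditive.sub_comp, Category.assoc,
    Category.assoc, cokernel.condition, comp_zero, comp_zero, sub_zero]

variable (A) in
/-- The functor from `A` to its stable category that takes `X` to `Σ X`. -/
def cosyzFunctor : A ⥤ Stable A where
  obj X := (CategoryTheory.Quotient.functor (stableRel A)).obj (cosyz X)
  map a := (CategoryTheory.Quotient.functor (stableRel A)).map (exists_cosyzMap a).choose_spec.choose
  map_id X := by
    rw [← (CategoryTheory.Quotient.functor (stableRel A)).map_id]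
    have h := (exists_cosyzMap (𝟙 X)).choose_spec.choose_spec
    exact CategoryTheory.Quotient.sound _ (cosyz_stable (stableRel_refl (𝟙 X)) h.1 (j' := 𝟙 _) (by simp) h.2
      (by simp [cosyz]))
  map_comp {X Y Z} a b := by
    rw [← (CategoryTheory.Quotient.functor (stableRel A)).map_comp]
    have h := (exists_cosyzMap (a ≫ b)).choose_spec.choose_spec
    have ha := (exists_cosyzMap a).choose_spec.choose_spec
    have hb := (exists_cosyzMap b).choose_spec.choose_spec
    refine CategoryTheory.Quotient.sound _ (cosyz_stable (stableRel_refl (a ≫ b)) h.1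
      (j' := (exists_cosyzMap a).choose ≫ (exists_cosyzMap b).choose) ?_ h.2 ?_)
    · rw [← Category.assoc, ha.1, Category.assoc, hb.1, Category.assoc]
    · rw [← Category.assoc, ha.2, Category.assoc, hb.2, Category.assoc]

variable (A) in
/-- The suspension functor `Σ` of the stable category. -/
def suspension : Stable A ⥤ Stable A :=
  CategoryTheory.Quotient.lift _ (cosyzFunctor A) (fun _ _ a b h => by
    have ha := (exists_cosyzMap a).choose_spec.choose_spec
    have hb := (exists_cosyzMap b).choose_spec.choose_spec
    exact CategoryTheory.Quotient.sound _ (cosyz_stable h ha.1 hb.1 ha.2 hb.2))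

variable (A) in
/-- The abelian category `A` is Frobenius and its stable category is 2-Calabi-Yau over `k`. -/
def StableIsTwoCalabiYau (k : Type w) [Field k] [Linear k A] : Prop :=
  EnoughProjectives A ∧ (∀ X : A, Projective X ↔ Injective X) ∧
    IsTwoCalabiYau k (Stable A) (suspension A ⋙ suspension A)

end Stable

end TorsionFrob

end

open TorsionFrob

/-! The class `T₁` is closed under quotients and extensions, and `F₂` under subobjects and
extensions. Hence `C₁₂` is closed under extensions and retracts. It inherits an exact structure from
`A`, checked by computing cokernels of inflations and kernels of deflations in `A`. A kernel taken
in `A` of a morphism of `C₁₂` stays in `F₂`, and `t₁` coreflects it into `T₁`; dually `f₂` corrects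
cokernels. So `C₁₂` is preabelian, and a finitely presented functor with presentation `f` is
resolved by the functors represented by `ker f`, `X` and `Y`, which bounds the global dimension by
two.

Morphisms from `P ∈ T₁` to objects of `F₂` factor uniquely through `f₂ P`. Projectivity of `P` thus
passes to `f₂ P`, and a deflation `P ⟶ X` in `T₁` induces a deflation `f₂ P ⟶ X` (`isProj_fCore`,
`exists_deflation_fCore`); injectives are dual. Projectivity and injectivity are the vanishing of
`Ext¹` in one or the other variable, so symmetric vanishing forces the Frobenius property. Since
`Ext¹` of `C₁₂` is that of `A`, the symmetry follows from the duality between `Ext¹(X, Y)` and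
`Ext¹(Y, X)` in the 2-Calabi-Yau situations.

For the Gorenstein statement let `Q` be a projective-injective generator with endomorphism ring `R`,
and `F = Hom(Q, -)`. Then `F` is fully faithful and exact, and injectivity of `Q` gives `Extⁱ(F X, F
Q) = 0` for `i > 0` (`subsingleton_ext_obj`). A finitely generated module `M` over the noetherian
ring has a resolution `0 ⟶ F K ⟶ F Q₁ ⟶ F Q₀ ⟶ M ⟶ 0` with `K` a kernel in the exact category
(`exists_resolution`), so `Ext³(M, F Q) = Ext¹(F K, F Q) = 0`, and Baer's criterion bounds the
injective dimension. If `M` is Gorenstein projective, morphisms to `Q` extend along the maps of this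
resolution. This makes them inflations by the obscure axiom, and their cokernels yield an object
with image `M` (`exists_iso_of_gp`). The functor `Hom(-, Q)` on the opposite category treats the
other side of the ring. -/

namespace TorsionFrob

/-! ### Extension-closed subcategories of an abelian category as exact categories -/

section ExtensionClosed

variable {A : Type u} [Category.{v} A] [Abelian A]

/-- In an abelian category the cokernel of a composition of two monomorphisms is an extension
of the cokernels. -/
lemma shortExact_cokernel_comp {X Y Z : A} (i : X ⟶ Y) (j : Y ⟶ Z) [Mono j] :
    (ShortComplex.mk (cokernel.map i (i ≫ j) (𝟙 _) j (by simp))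
      (cokernel.map (i ≫ j) j i (𝟙 _) (by simp)) (by
        rw [← cancel_epi (cokernel.π i)]; simp)).ShortExact := by
  have h := (kernelCokernelCompSequence_exact i j)
  have hm : Mono (cokernel.map i (i ≫ j) (𝟙 _) j (by simp)) := by
    refine ((h.exact 2).mono_g_iff).2 ?_
    exact (isZero_kernel_of_mono j).eq_of_src _ _
  have : Epi (cokernel.map (i ≫ j) j i (𝟙 _) (by simp)) := by
    exact epi_of_epi_fac (f := cokernel.π (i ≫ j)) (h := cokernel.π j) (by simp)
  exact ShortComplex.ShortExact.mk' (h.exact 3) hm this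

/-- In an abelian category the kernel of a composition of two epimorphisms is an extension
of the kernels. -/
lemma shortExact_kernel_comp {X Y Z : A} (p : X ⟶ Y) (q : Y ⟶ Z) [Epi p] :
    (ShortComplex.mk (kernel.map p (p ≫ q) (𝟙 _) q (by simp))
      (kernel.map (p ≫ q) q p (𝟙 _) (by simp)) (by
        rw [← cancel_mono (kernel.ι q)]; simp)).ShortExact := by
  have h := (kernelCokernelCompSequence_exact p q)
  have he : Epi (kernel.map (p ≫ q) q p (𝟙 _) (by simp)) := by
    refine ((h.exact 1).epi_f_iff).2 ?_
    exact (isZero_cokernel_of_epi p).eq_of_tgt _ _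
  have : Mono (kernel.map p (p ≫ q) (𝟙 _) q (by simp)) := by
    exact mono_of_mono_fac (show kernel.map p (p ≫ q) (𝟙 _) q (by simp) ≫ kernel.ι (p ≫ q) =
      kernel.ι p by simp)
  exact ShortComplex.ShortExact.mk' (h.exact 0) this he

variable (P : ObjectProperty A)

lemma isInflation_of_cokernel {X Y : P.FullSubcategory} (i : X ⟶ Y) [Mono i.hom]
    (h : P (cokernel i.hom)) : IsInflation (confl P) i := by
  refine ⟨⟨_, h⟩, ObjectProperty.homMk (cokernel.π i.hom), ?_, ?_⟩
  · ext; exact cokernel.condition _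
  · exact ShortComplex.ShortExact.mk' (ShortComplex.exact_cokernel i.hom) ‹_›
      (inferInstanceAs (Epi (cokernel.π i.hom)))

lemma isDeflation_of_kernel {X Y : P.FullSubcategory} (p : X ⟶ Y) [Epi p.hom]
    (h : P (kernel p.hom)) : IsDeflation (confl P) p := by
  refine ⟨⟨_, h⟩, ObjectProperty.homMk (kernel.ι p.hom), ?_, ?_⟩
  · ext; exact kernel.condition _
  · exact ShortComplex.ShortExact.mk' (ShortComplex.exact_kernel p.hom)
      (inferInstanceAs (Mono (kernel.ι p.hom))) ‹_›

/-- The last term of a conflation is a cokernel in `A` of its first map. Quillen's axioms for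
inflations thereby become statements about cokernels in `A`. -/
lemma isInflation_iff [P.IsClosedUnderIsomorphisms] {X Y : P.FullSubcategory} (i : X ⟶ Y) :
    IsInflation (confl P) i ↔ Mono i.hom ∧ P (cokernel i.hom) := by
  refine ⟨?_, fun ⟨_, h⟩ => isInflation_of_cokernel P i h⟩
  rintro ⟨Z, p, w, h⟩
  have h : (ShortComplex.mk i.hom p.hom (congrArg (fun f => f.hom) w)).ShortExact := h
  exact ⟨h.mono_f, P.prop_of_iso ((cokernelIsCokernel i.hom).coconePointUniqueUpToIso
    h.gIsCokernel).symm Z.property⟩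

lemma isDeflation_iff [P.IsClosedUnderIsomorphisms] {X Y : P.FullSubcategory} (p : X ⟶ Y) :
    IsDeflation (confl P) p ↔ Epi p.hom ∧ P (kernel p.hom) := by
  refine ⟨?_, fun ⟨_, h⟩ => isDeflation_of_kernel P p h⟩
  rintro ⟨Z, i, w, h⟩
  have h : (ShortComplex.mk i.hom p.hom (congrArg (fun f => f.hom) w)).ShortExact := h
  exact ⟨h.epi_g, P.prop_of_iso ((kernelIsKernel p.hom).conePointUniqueUpToIso
    h.fIsKernel).symm Z.property⟩

lemma confl_kernel_cokernel (S : ShortComplex P.FullSubcategory) (hS : confl P S) :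
    Nonempty (IsLimit (KernelFork.ofι S.f S.zero)) ∧
      Nonempty (IsColimit (CokernelCofork.ofπ S.g S.zero)) := by
  have hS : (S.map P.ι).ShortExact := hS
  have hm := hS.mono_f
  have he := hS.epi_g
  have : Mono S.f := P.ι.mono_of_mono_map hm
  have : Epi S.g := P.ι.epi_of_epi_map he
  refine ⟨⟨KernelFork.IsLimit.ofι' _ _ fun k hk => ⟨ObjectProperty.homMk
    (hS.exact.lift k.hom (congrArg (fun f => f.hom) hk)), ?_⟩⟩,
    ⟨CokernelCofork.IsColimit.ofπ' _ _ fun k hk => ⟨ObjectProperty.homMk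
    (hS.exact.desc k.hom (congrArg (fun f => f.hom) hk)), ?_⟩⟩⟩
  · ext; exact hS.exact.lift_f _ _
  · ext; exact hS.exact.g_desc _ _

/-- An extension-closed full subcategory of an abelian category is an exact category. -/
theorem isExactStructure_confl [P.IsClosedUnderIsomorphisms] [P.IsClosedUnderExtensions]
    [P.ContainsZero] : IsExactStructure (confl P) where
  iso_closed := ⟨fun e h => ShortComplex.shortExact_of_iso (P.ι.mapShortComplex.mapIso e) h⟩
  kernel_cokernel := confl_kernel_cokernel P
  id_inflation X := by
    have : Mono (𝟙 X : X ⟶ X).hom := inferInstanceAs (Mono (𝟙 X.obj))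
    exact isInflation_of_cokernel P _ (P.prop_of_isZero
      (isZero_cokernel_of_epi (𝟙 X.obj)))
  id_deflation X := by
    have : Epi (𝟙 X : X ⟶ X).hom := inferInstanceAs (Epi (𝟙 X.obj))
    exact isDeflation_of_kernel P _ (P.prop_of_isZero
      (isZero_kernel_of_mono (𝟙 X.obj)))
  comp_inflation i j hi hj := by
    rw [isInflation_iff] at hi hj
    obtain ⟨_, hi⟩ := hi
    obtain ⟨_, hj⟩ := hj
    have : Mono (i ≫ j).hom := mono_comp i.hom j.hom
    exact isInflation_of_cokernel P _ (P.prop_X₂_of_shortExact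
      (shortExact_cokernel_comp i.hom j.hom) hi hj)
  comp_deflation p q hp hq := by
    rw [isDeflation_iff] at hp hq
    obtain ⟨_, hp⟩ := hp
    obtain ⟨_, hq⟩ := hq
    have : Epi (p ≫ q).hom := epi_comp p.hom q.hom
    exact isDeflation_of_kernel P _ (P.prop_X₂_of_shortExact
      (shortExact_kernel_comp p.hom q.hom) hp hq)
  pushout_inflation {X Y X'} i a hi := by
    rw [isInflation_iff] at hi
    obtain ⟨_, hi⟩ := hi
    have sq := IsPushout.of_hasPushout i.hom a.hom
    -- Pushing out does not change the cokernel, so the pushout is an extension of the cokernel of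
    -- `i` by `X'`.
    have hc : P (cokernel (pushout.inr i.hom a.hom)) := by
      have := isIso_cokernel_map_of_isPushout sq
      exact P.prop_of_iso (asIso (cokernel.map _ _ _ _ sq.w)) hi
    have hY : P (pushout i.hom a.hom) :=
      P.prop_X₂_of_shortExact (ShortComplex.ShortExact.mk'
        (ShortComplex.exact_cokernel (pushout.inr i.hom a.hom)) inferInstance
        (inferInstanceAs (Epi (cokernel.π _)))) X'.property hc
    let Y' : P.FullSubcategory := ⟨_, hY⟩
    let b : Y ⟶ Y' := ObjectProperty.homMk (pushout.inl i.hom a.hom)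
    let i' : X' ⟶ Y' := ObjectProperty.homMk (pushout.inr i.hom a.hom)
    have : Mono i'.hom := inferInstanceAs (Mono (pushout.inr i.hom a.hom))
    exact ⟨Y', b, i', IsPushout.of_map_of_faithful P.ι sq, isInflation_of_cokernel P i' hc⟩
  pullback_deflation {Y Z Z'} p a hp := by
    rw [isDeflation_iff] at hp
    obtain ⟨_, hp⟩ := hp
    have sq := IsPullback.of_hasPullback p.hom a.hom
    have hc : P (kernel (pullback.snd p.hom a.hom)) := by
      have := isIso_kernel_map_of_isPullback sq.flip
      exact P.prop_of_iso (asIso (kernel.map _ _ _ _ sq.flip.w)).symm hp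
    have hY : P (pullback p.hom a.hom) :=
      P.prop_X₂_of_shortExact (ShortComplex.ShortExact.mk'
        (ShortComplex.exact_kernel (pullback.snd p.hom a.hom))
        (inferInstanceAs (Mono (kernel.ι _))) inferInstance) hc Z'.property
    let Y' : P.FullSubcategory := ⟨_, hY⟩
    let b : Y' ⟶ Y := ObjectProperty.homMk (pullback.fst p.hom a.hom)
    let p' : Y' ⟶ Z' := ObjectProperty.homMk (pullback.snd p.hom a.hom)
    have : Epi p'.hom := inferInstanceAs (Epi (pullback.snd p.hom a.hom))
    exact ⟨Y', b, p', IsPullback.of_map_of_faithful P.ι sq, isDeflation_of_kernel P p' hc⟩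

/-- A biproduct is a split extension of its two summands. -/
lemma isClosedUnderFiniteProducts_of_extensions [P.IsClosedUnderIsomorphisms]
    [P.IsClosedUnderExtensions] [P.ContainsZero] : P.IsClosedUnderFiniteProducts := by
  have : P.IsClosedUnderBinaryProducts := ⟨by
    rintro X ⟨p⟩
    let e : X ≅ p.diag.obj ⟨.left⟩ ⊞ p.diag.obj ⟨.right⟩ :=
      IsLimit.conePointsIsoOfNatIso p.isLimit (BinaryBiproduct.isLimit _ _)
        (mapPairIso (Iso.refl _) (Iso.refl _))
    exact P.prop_of_iso e.symm (P.prop_biprod (p.prop_diag_obj _) (p.prop_diag_obj _))⟩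
  exact ObjectProperty.IsClosedUnderFiniteProducts.mk'

end ExtensionClosed

end TorsionFrob

namespace TorsionFrob

/-! ### Projectives, injectives and splitting in an exact category -/

section ExactCategory

variable {E : Type u} [Category.{v} E] [Preadditive E] {c : ObjectProperty (ShortComplex E)}

lemma IsProj.of_retract {X Y : E} (hY : IsProj c Y) (r : Retract X Y) : IsProj c X := by
  intro S hS a
  obtain ⟨b, hb⟩ := hY S hS (r.r ≫ a)
  exact ⟨r.i ≫ b, by rw [Category.assoc, hb, r.retract_assoc]⟩

lemma IsInj.of_retract {X Y : E} (hY : IsInj c Y) (r : Retract X Y) : IsInj c X := by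
  intro S hS a
  obtain ⟨b, hb⟩ := hY S hS (a ≫ r.i)
  exact ⟨b ≫ r.r, by rw [← Category.assoc, hb, Category.assoc, r.retract, Category.comp_id]⟩

lemma IsProj.retract {X Y : E} (hX : IsProj c X) {p : Y ⟶ X} (hp : IsDeflation c p) :
    Nonempty (Retract X Y) := by
  obtain ⟨K, i, w, h⟩ := hp
  obtain ⟨b, hb⟩ := hX _ h (𝟙 X)
  exact ⟨⟨b, p, hb⟩⟩

lemma IsInj.retract {X Y : E} (hX : IsInj c X) {i : X ⟶ Y} (hi : IsInflation c i) :
    Nonempty (Retract X Y) := by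
  obtain ⟨K, p, w, h⟩ := hi
  obtain ⟨b, hb⟩ := hX _ h (𝟙 X)
  exact ⟨⟨i, b, hb⟩⟩

/-- If each object is a deflation quotient of an object `F P` with `P` in `Q`, and such `F P` are
projective, then the projective objects are the direct summands of such objects. -/
lemma isProj_iff_retract {D : Type w} (F : D → E) (Q : D → Prop)
    (h₁ : ∀ P, Q P → IsProj c (F P)) (h₂ : ∀ X : E, ∃ (P : D) (p : F P ⟶ X), Q P ∧ IsDeflation c p)
    (X : E) : IsProj c X ↔ ∃ P, Q P ∧ Nonempty (Retract X (F P)) := by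
  constructor
  · intro hX
    obtain ⟨P, p, hP, hp⟩ := h₂ X
    exact ⟨P, hP, hX.retract hp⟩
  · rintro ⟨P, hP, ⟨r⟩⟩
    exact (h₁ P hP).of_retract r

lemma isInj_iff_retract {D : Type w} (F : D → E) (Q : D → Prop)
    (h₁ : ∀ P, Q P → IsInj c (F P)) (h₂ : ∀ X : E, ∃ (P : D) (p : X ⟶ F P), Q P ∧ IsInflation c p)
    (X : E) : IsInj c X ↔ ∃ P, Q P ∧ Nonempty (Retract X (F P)) := by
  constructor
  · intro hX
    obtain ⟨P, p, hP, hp⟩ := h₂ X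
    exact ⟨P, hP, hX.retract hp⟩
  · rintro ⟨P, hP, ⟨r⟩⟩
    exact (h₁ P hP).of_retract r

/-- The endomorphism `𝟙 - g ≫ s` of the middle term is killed by `g`; its factorization through the
kernel is the retraction. -/
lemma shortExactSplitting_of_section {S : ShortComplex E} (hS : Nonempty (IsLimit (KernelFork.ofι S.f S.zero)))
    (s : S.X₃ ⟶ S.X₂) (h : s ≫ S.g = 𝟙 _) : Nonempty S.Splitting := by
  obtain ⟨hl⟩ := hS
  have hm : Mono S.f := mono_of_isLimit_fork hl
  obtain ⟨r, hr⟩ := KernelFork.IsLimit.lift' hl (𝟙 _ - S.g ≫ s)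
    (by rw [Preadditive.sub_comp, Category.assoc, h]; simp)
  have hr : r ≫ S.f = 𝟙 _ - S.g ≫ s := hr
  refine ⟨⟨r, s, ?_, h, by rw [hr]; abel⟩⟩
  rw [← cancel_mono S.f, Category.assoc, hr, Preadditive.comp_sub, S.zero_assoc]
  simp

lemma shortExactSplitting_of_retraction {S : ShortComplex E}
    (hS : Nonempty (IsColimit (CokernelCofork.ofπ S.g S.zero)))
    (r : S.X₂ ⟶ S.X₁) (h : S.f ≫ r = 𝟙 _) : Nonempty S.Splitting := by
  obtain ⟨hl⟩ := hS
  have hm : Epi S.g := epi_of_isColimit_cofork hl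
  obtain ⟨s, hs⟩ := CokernelCofork.IsColimit.desc' hl (𝟙 _ - r ≫ S.f)
    (by rw [Preadditive.comp_sub, reassoc_of% h]; simp)
  have hs : S.g ≫ s = 𝟙 _ - r ≫ S.f := hs
  refine ⟨⟨r, s, h, ?_, by rw [hs]; abel⟩⟩
  rw [← cancel_epi S.g, reassoc_of% hs, Preadditive.sub_comp, Category.assoc, S.zero]
  simp

/-- A lifting problem `a` against a deflation becomes a splitting problem after pulling the
conflation back along `a`. -/
lemma isProj_iff_extOneVanishes (hc : IsExactStructure c) (X : E) :
    IsProj c X ↔ ∀ Y, ExtOneVanishes c X Y := by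
  constructor
  · intro hX Y M i p w h
    obtain ⟨b, hb⟩ := hX _ h (𝟙 X)
    exact shortExactSplitting_of_section (hc.kernel_cokernel _ h).1 b hb
  · intro hX S hS a
    obtain ⟨Y', b, p', sq, ⟨K, i, w, h⟩⟩ := hc.pullback_deflation S.g a ⟨_, _, _, hS⟩
    obtain ⟨σ⟩ := hX _ _ i p' w h
    refine ⟨σ.s ≫ b, ?_⟩
    rw [Category.assoc, sq.w]
    exact σ.s_g_assoc a

lemma isInj_iff_extOneVanishes (hc : IsExactStructure c) (Y : E) :
    IsInj c Y ↔ ∀ X, ExtOneVanishes c X Y := by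
  constructor
  · intro hY X M i p w h
    obtain ⟨b, hb⟩ := hY _ h (𝟙 Y)
    exact shortExactSplitting_of_retraction (hc.kernel_cokernel _ h).2 b hb
  · intro hY S hS a
    obtain ⟨Y', b, i', sq, ⟨K, p, w, h⟩⟩ := hc.pushout_inflation S.f a ⟨_, _, _, hS⟩
    obtain ⟨σ⟩ := hY _ _ i' p w h
    refine ⟨b ≫ σ.r, ?_⟩
    rw [← Category.assoc, sq.w, Category.assoc]
    have : i' ≫ σ.r = 𝟙 _ := σ.f_r
    rw [this, Category.comp_id]

/-- An exact category with enough projectives and injectives and symmetric vanishing of `Ext¹` is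
a Frobenius category. -/
lemma isFrobenius_of_extOneSymmetric (hc : IsExactStructure c) (hp : HasEnoughProj c)
    (hi : HasEnoughInj c) (hs : ExtOneSymmetric c) : IsFrobenius c :=
  ⟨hc, hp, hi, fun X => by
    rw [isProj_iff_extOneVanishes hc, isInj_iff_extOneVanishes hc]
    exact forall_congr' fun Y => hs X Y⟩

end ExactCategory

/-! ### Closure properties of torsion and torsion-free classes -/

namespace TorsionPair

variable {A : Type u} [Category.{v} A] [Abelian A] (τ : TorsionPair A)

/-- Orthogonality to `f X` already forces `t X ⟶ X` to be an epimorphism. In this form closure under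
extensions is a diagram chase. -/
lemma tors_iff (X : A) : τ.tors X ↔ ∀ Y, τ.free Y → ∀ a : X ⟶ Y, a = 0 := by
  refine ⟨fun hX Y hY a => τ.hom_eq_zero hX hY a, fun h => ?_⟩
  have : Epi (τ.incl X) := (τ.ses X).exact.epi_f_iff.2 (h _ (τ.free_f X) (τ.proj X))
  exact τ.tors_of_epi (τ.tors_t X) (τ.incl X)

lemma free_iff (Y : A) : τ.free Y ↔ ∀ X, τ.tors X → ∀ a : X ⟶ Y, a = 0 := by
  refine ⟨fun hY X hX a => τ.hom_eq_zero hX hY a, fun h => ?_⟩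
  have : Mono (τ.proj Y) := (τ.ses Y).exact.mono_g_iff.2 (h _ (τ.tors_t Y) (τ.incl Y))
  exact τ.free_of_mono (τ.free_f Y) (τ.proj Y)

instance : τ.tors.IsClosedUnderQuotients := ⟨fun p _ h => τ.tors_of_epi h p⟩

instance : τ.free.IsClosedUnderSubobjects := ⟨fun i _ h => τ.free_of_mono h i⟩

instance : τ.tors.IsClosedUnderExtensions where
  prop_X₂_of_shortExact {S} hS h₁ h₃ := by
    rw [tors_iff]
    intro Y hY a
    have := hS.epi_g
    rw [← hS.exact.g_desc a (τ.hom_eq_zero h₁ hY _), τ.hom_eq_zero h₃ hY (hS.exact.desc a _),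
      comp_zero]

instance : τ.free.IsClosedUnderExtensions where
  prop_X₂_of_shortExact {S} hS h₁ h₃ := by
    rw [free_iff]
    intro X hX a
    have := hS.mono_f
    rw [← hS.exact.lift_f a (τ.hom_eq_zero hX h₃ _), τ.hom_eq_zero hX h₁ (hS.exact.lift a _),
      zero_comp]

instance : τ.tors.ContainsZero :=
  ⟨⟨0, isZero_zero _, (τ.tors_iff _).2 fun _ _ a => (isZero_zero A).eq_of_src a 0⟩⟩

instance : τ.free.ContainsZero :=
  ⟨⟨0, isZero_zero _, (τ.free_iff _).2 fun _ _ a => (isZero_zero A).eq_of_tgt a 0⟩⟩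

end TorsionPair

/-! ### The category `C₁₂` is idempotent complete and preabelian -/

section Core

variable {A : Type u} [Category.{v} A] [Abelian A] (τ₁ τ₂ : TorsionPair A)

instance : (core τ₁ τ₂).IsClosedUnderIsomorphisms :=
  ⟨fun e h => ⟨τ₁.tors.prop_of_iso e h.1, τ₂.free.prop_of_iso e h.2⟩⟩

instance : (core τ₁ τ₂).IsClosedUnderExtensions :=
  ⟨fun hS h₁ h₃ => ⟨τ₁.tors.prop_X₂_of_shortExact hS h₁.1 h₃.1,
    τ₂.free.prop_X₂_of_shortExact hS h₁.2 h₃.2⟩⟩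

instance : (core τ₁ τ₂).ContainsZero :=
  ⟨⟨0, isZero_zero _, τ₁.tors.prop_of_isZero (isZero_zero A),
    τ₂.free.prop_of_isZero (isZero_zero A)⟩⟩

instance : (core τ₁ τ₂).IsClosedUnderFiniteProducts :=
  isClosedUnderFiniteProducts_of_extensions _

instance : HasFiniteBiproducts (core τ₁ τ₂).FullSubcategory :=
  HasFiniteBiproducts.of_hasFiniteProducts

-- A retract is a quotient, hence in `T₁`, and a subobject, hence in `F₂`.
variable {τ₁ τ₂} in
lemma core_of_retract {X Y : A} (hY : core τ₁ τ₂ Y) (r : Retract X Y) : core τ₁ τ₂ X :=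
  ⟨τ₁.tors_of_epi hY.1 r.r, τ₂.free_of_mono hY.2 r.i⟩

lemma isIdempotentComplete_core : IsIdempotentComplete (core τ₁ τ₂).FullSubcategory where
  idempotents_split X p hp := by
    obtain ⟨Y, i, e, h₁, h₂⟩ := IsIdempotentComplete.idempotents_split X.obj p.hom
      (congrArg (fun f => f.hom) hp)
    exact ⟨⟨Y, core_of_retract X.property ⟨i, e, h₁⟩⟩, ObjectProperty.homMk i,
      ObjectProperty.homMk e, by ext; exact h₁, by ext; exact h₂⟩

/-- The kernel in `A` is a subobject of `X`, hence lies in `F₂`, and so does its `t₁`. A test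
morphism has source in `T₁`, so its factorization through the kernel lands in `t₁`. -/
lemma core_kernel {X Y : (core τ₁ τ₂).FullSubcategory} (a : X ⟶ Y) :
    ∃ (hK : core τ₁ τ₂ (τ₁.t (kernel a.hom)))
      (w : (ObjectProperty.homMk (τ₁.incl (kernel a.hom) ≫ kernel.ι a.hom) :
        (⟨_, hK⟩ : (core τ₁ τ₂).FullSubcategory) ⟶ X) ≫ a = 0),
      Nonempty (IsLimit (KernelFork.ofι _ w)) := by
  refine ⟨core_t τ₁ τ₂ (τ₂.free_of_mono X.property.2 (kernel.ι a.hom)), ?_, ?_⟩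
  · ext
    exact (Category.assoc _ _ _).trans (by rw [kernel.condition, comp_zero]; rfl)
  · have : Mono (ObjectProperty.homMk (τ₁.incl (kernel a.hom) ≫ kernel.ι a.hom) :
        (⟨_, core_t τ₁ τ₂ (τ₂.free_of_mono X.property.2 (kernel.ι a.hom))⟩ :
          (core τ₁ τ₂).FullSubcategory) ⟶ X) :=
      (core τ₁ τ₂).ι.mono_of_mono_map
        (inferInstanceAs (Mono (τ₁.incl (kernel a.hom) ≫ kernel.ι a.hom)))
    refine ⟨KernelFork.IsLimit.ofι' _ _ fun {W} k hk => ⟨ObjectProperty.homMk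
      ((τ₁.ses _).exact.lift (kernel.lift a.hom k.hom (congrArg (fun f => f.hom) hk))
        (τ₁.hom_eq_zero W.property.1 (τ₁.free_f _) _)), ?_⟩⟩
    ext
    have h := (τ₁.ses _).exact.lift_f (kernel.lift a.hom k.hom (congrArg (fun f => f.hom) hk))
        (τ₁.hom_eq_zero W.property.1 (τ₁.free_f _) _)
    exact (Category.assoc _ _ _).symm.trans ((congrArg (· ≫ kernel.ι a.hom) h).trans
      (kernel.lift_ι _ _ _))

/-- Dual to the kernel: the cokernel in `A` is a quotient of `Y`, and morphisms from it to objects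
of `F₂` factor through `f₂`. -/
lemma core_cokernel {X Y : (core τ₁ τ₂).FullSubcategory} (a : X ⟶ Y) :
    ∃ (hQ : core τ₁ τ₂ (τ₂.f (cokernel a.hom)))
      (w : a ≫ (ObjectProperty.homMk (cokernel.π a.hom ≫ τ₂.proj (cokernel a.hom)) :
        Y ⟶ (⟨_, hQ⟩ : (core τ₁ τ₂).FullSubcategory)) = 0),
      Nonempty (IsColimit (CokernelCofork.ofπ _ w)) := by
  refine ⟨core_f τ₁ τ₂ (τ₁.tors_of_epi Y.property.1 (cokernel.π a.hom)), ?_, ?_⟩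
  · ext
    exact (Category.assoc _ _ _).symm.trans (by rw [cokernel.condition, zero_comp]; rfl)
  · have : Epi (ObjectProperty.homMk (cokernel.π a.hom ≫ τ₂.proj (cokernel a.hom)) :
        Y ⟶ (⟨_, core_f τ₁ τ₂ (τ₁.tors_of_epi Y.property.1 (cokernel.π a.hom))⟩ :
          (core τ₁ τ₂).FullSubcategory)) :=
      (core τ₁ τ₂).ι.epi_of_epi_map
        (inferInstanceAs (Epi (cokernel.π a.hom ≫ τ₂.proj (cokernel a.hom))))
    refine ⟨CokernelCofork.IsColimit.ofπ' _ _ fun {W} k hk => ⟨ObjectProperty.homMk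
      ((τ₂.ses _).exact.desc (cokernel.desc a.hom k.hom (congrArg (fun f => f.hom) hk))
        (τ₂.hom_eq_zero (τ₂.tors_t _) W.property.2 _)), ?_⟩⟩
    ext
    have h := (τ₂.ses _).exact.g_desc (cokernel.desc a.hom k.hom (congrArg (fun f => f.hom) hk))
        (τ₂.hom_eq_zero (τ₂.tors_t _) W.property.2 _)
    exact (Category.assoc _ _ _).trans ((congrArg (cokernel.π a.hom ≫ ·) h).trans
      (cokernel.π_desc _ _ _))

instance : HasKernels (core τ₁ τ₂).FullSubcategory :=
  ⟨fun a => by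
    obtain ⟨_, _, ⟨h⟩⟩ := core_kernel τ₁ τ₂ a
    exact ⟨⟨_, h⟩⟩⟩

instance : HasCokernels (core τ₁ τ₂).FullSubcategory :=
  ⟨fun a => by
    obtain ⟨_, _, ⟨h⟩⟩ := core_cokernel τ₁ τ₂ a
    exact ⟨⟨_, h⟩⟩⟩

/-! ### Projective and injective objects of `C₁₂` -/

/-- The canonical morphism `P ⟶ f₂ P`, seen as a morphism `P.obj ⟶ (f₂ P).obj` of `A`. -/
noncomputable abbrev toCore (P : τ₁.tors.FullSubcategory) : P.obj ⟶ ((fCore τ₁ τ₂).obj P).obj :=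
  τ₂.proj P.obj

/-- The canonical morphism `t₁ I ⟶ I`, seen as a morphism `(t₁ I).obj ⟶ I.obj` of `A`. -/
noncomputable abbrev fromCore (I : τ₂.free.FullSubcategory) : ((tCore τ₁ τ₂).obj I).obj ⟶ I.obj :=
  τ₁.incl I.obj

lemma toCore_fCore_map {P P' : τ₁.tors.FullSubcategory} (a : P ⟶ P') :
    toCore τ₁ τ₂ P ≫ ((fCore τ₁ τ₂).map a).hom = a.hom ≫ toCore τ₁ τ₂ P' :=
  τ₂.proj_fFunctor_map a.hom

lemma tCore_map_fromCore {I I' : τ₂.free.FullSubcategory} (a : I ⟶ I') :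
    ((tCore τ₁ τ₂).map a).hom ≫ fromCore τ₁ τ₂ I' = fromCore τ₁ τ₂ I ≫ a.hom :=
  τ₁.tFunctor_map_incl a.hom

/-- There are no nonzero morphisms from `t₂ P` to an object of `F₂`; this is the reflection property
of `f₂`. -/
lemma exists_fac_toCore (P : τ₁.tors.FullSubcategory) {X : A} (hX : τ₂.free X) (a : P.obj ⟶ X) :
    ∃ b : ((fCore τ₁ τ₂).obj P).obj ⟶ X, toCore τ₁ τ₂ P ≫ b = a :=
  ⟨(τ₂.ses P.obj).exact.desc a (τ₂.hom_eq_zero (τ₂.tors_t _) hX _), (τ₂.ses P.obj).exact.g_desc _ _⟩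

lemma exists_fac_fromCore (I : τ₂.free.FullSubcategory) {X : A} (hX : τ₁.tors X) (a : X ⟶ I.obj) :
    ∃ b : X ⟶ ((tCore τ₁ τ₂).obj I).obj, b ≫ fromCore τ₁ τ₂ I = a :=
  ⟨(τ₁.ses I.obj).exact.lift a (τ₁.hom_eq_zero hX (τ₁.free_f _) _), (τ₁.ses I.obj).exact.lift_f _ _⟩

instance (P : τ₁.tors.FullSubcategory) : Epi (toCore τ₁ τ₂ P) :=
  inferInstanceAs (Epi (τ₂.proj P.obj))

instance (I : τ₂.free.FullSubcategory) : Mono (fromCore τ₁ τ₂ I) :=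
  inferInstanceAs (Mono (τ₁.incl I.obj))

/-- A conflation of `C₁₂` is one of `T₁`, so the composite from `P` lifts. The lift has target in
`F₂` and therefore descends to `f₂ P`. -/
lemma isProj_fCore {P : τ₁.tors.FullSubcategory} (hP : IsProj (confl τ₁.tors) P) :
    IsProj (confl (core τ₁ τ₂)) ((fCore τ₁ τ₂).obj P) := by
  intro S hS a
  let S' : ShortComplex τ₁.tors.FullSubcategory :=
    S.map (ObjectProperty.ιOfLE (P := core τ₁ τ₂) (P' := τ₁.tors) (fun _ h => h.1))
  obtain ⟨b, hb⟩ := hP S' hS (ObjectProperty.homMk (toCore τ₁ τ₂ P ≫ a.hom))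
  have hb : b.hom ≫ S.g.hom = toCore τ₁ τ₂ P ≫ a.hom := congrArg (fun f => f.hom) hb
  obtain ⟨d, hd⟩ := exists_fac_toCore τ₁ τ₂ P (X := S.X₂.obj) S.X₂.property.2 b.hom
  refine ⟨ObjectProperty.homMk d, ?_⟩
  ext
  change d ≫ S.g.hom = a.hom
  rw [← cancel_epi (toCore τ₁ τ₂ P), ← Category.assoc, hd]
  exact hb

lemma isInj_tCore {I : τ₂.free.FullSubcategory} (hI : IsInj (confl τ₂.free) I) :
    IsInj (confl (core τ₁ τ₂)) ((tCore τ₁ τ₂).obj I) := by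
  intro S hS a
  let S' : ShortComplex τ₂.free.FullSubcategory :=
    S.map (ObjectProperty.ιOfLE (P := core τ₁ τ₂) (P' := τ₂.free) (fun _ h => h.2))
  obtain ⟨b, hb⟩ := hI S' hS (ObjectProperty.homMk (a.hom ≫ fromCore τ₁ τ₂ I))
  have hb : S.f.hom ≫ b.hom = a.hom ≫ fromCore τ₁ τ₂ I := congrArg (fun f => f.hom) hb
  obtain ⟨d, hd⟩ := exists_fac_fromCore τ₁ τ₂ I (X := S.X₂.obj) S.X₂.property.1 b.hom
  refine ⟨ObjectProperty.homMk d, ?_⟩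
  ext
  change S.f.hom ≫ d = a.hom
  rw [← cancel_mono (fromCore τ₁ τ₂ I), Category.assoc, hd]
  exact hb

/-- Factor a deflation `P ⟶ X` of `T₁` through `d : f₂ P ⟶ X`. The kernel of `d` is a quotient of
the kernel of `P ⟶ X`, hence in `T₁`, and a subobject of `f₂ P`, hence in `F₂`. -/
lemma exists_deflation_fCore (h : HasEnoughProj (confl τ₁.tors))
    (X : (core τ₁ τ₂).FullSubcategory) :
    ∃ (P : τ₁.tors.FullSubcategory) (p : (fCore τ₁ τ₂).obj P ⟶ X),
      IsProj (confl τ₁.tors) P ∧ IsDeflation (confl (core τ₁ τ₂)) p := by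
  obtain ⟨P, p, hP, hp⟩ := h ⟨X.obj, X.property.1⟩
  rw [isDeflation_iff] at hp
  obtain ⟨_, hp⟩ := hp
  obtain ⟨d, hd⟩ := exists_fac_toCore τ₁ τ₂ P (X := X.obj) X.property.2 p.hom
  have : Epi d := epi_of_epi_fac hd
  have : Epi (ObjectProperty.homMk d : (fCore τ₁ τ₂).obj P ⟶ X).hom := this
  refine ⟨P, ObjectProperty.homMk d, hP, isDeflation_of_kernel _ _
    ⟨?_, τ₂.free_of_mono ((fCore τ₁ τ₂).obj P).property.2 (kernel.ι d)⟩⟩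
  have := (shortExact_kernel_comp (toCore τ₁ τ₂ P) d).epi_g
  refine τ₁.tors_of_epi ?_ (kernel.map (toCore τ₁ τ₂ P ≫ d) d (toCore τ₁ τ₂ P) (𝟙 _) (by simp))
  rw [hd]
  exact hp

/-- Dually, the cokernel of `d : X ⟶ t₁ I` is a quotient of `t₁ I` and embeds into the cokernel of
`X ⟶ I`. -/
lemma exists_inflation_tCore (h : HasEnoughInj (confl τ₂.free))
    (X : (core τ₁ τ₂).FullSubcategory) :
    ∃ (I : τ₂.free.FullSubcategory) (i : X ⟶ (tCore τ₁ τ₂).obj I),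
      IsInj (confl τ₂.free) I ∧ IsInflation (confl (core τ₁ τ₂)) i := by
  obtain ⟨I, i, hI, hi⟩ := h ⟨X.obj, X.property.2⟩
  rw [isInflation_iff] at hi
  obtain ⟨_, hi⟩ := hi
  obtain ⟨d, hd⟩ := exists_fac_fromCore τ₁ τ₂ I (X := X.obj) X.property.1 i.hom
  have : Mono d := mono_of_mono_fac hd
  have : Mono (ObjectProperty.homMk d : X ⟶ (tCore τ₁ τ₂).obj I).hom := this
  refine ⟨I, ObjectProperty.homMk d, hI, isInflation_of_cokernel _ _
    ⟨τ₁.tors_of_epi ((tCore τ₁ τ₂).obj I).property.1 (cokernel.π d), ?_⟩⟩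
  have := (shortExact_cokernel_comp d (fromCore τ₁ τ₂ I)).mono_f
  refine τ₂.free_of_mono ?_ (cokernel.map d (d ≫ fromCore τ₁ τ₂ I) (𝟙 _) (fromCore τ₁ τ₂ I)
    (by simp))
  rw [hd]
  exact hi

/-! ### The induced homomorphisms of endomorphism rings -/

/-- As `P ⟶ f₂ P` is epi, `f₂ a` vanishes exactly when `a` followed by it does, that is, when `a`
lands in `t₂ P`. An arbitrary second factor `y` is harmless, because `y` followed by `P ⟶ f₂ P` is
zero. -/
lemma endRingHom_fCore_eq_zero_iff (P : τ₁.tors.FullSubcategory) (a : End P) :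
    endRingHom (fCore τ₁ τ₂) P a = 0 ↔
      ∃ (x : P.obj ⟶ τ₂.t P.obj) (y : τ₂.t P.obj ⟶ P.obj), a.hom = x ≫ y := by
  have key : endRingHom (fCore τ₁ τ₂) P a = 0 ↔ a.hom ≫ τ₂.proj P.obj = 0 := by
    have h : toCore τ₁ τ₂ P ≫ ((fCore τ₁ τ₂).map a).hom = a.hom ≫ τ₂.proj P.obj :=
      toCore_fCore_map τ₁ τ₂ a
    rw [← h]
    constructor
    · intro h0
      have h0 : (fCore τ₁ τ₂).map a = 0 := h0
      rw [h0]
      exact comp_zero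
    · intro h0
      refine ObjectProperty.hom_ext _ ?_
      rw [← cancel_epi (toCore τ₁ τ₂ P)]
      exact h0.trans comp_zero.symm
  rw [key]
  constructor
  · intro h
    exact ⟨(τ₂.ses P.obj).exact.lift a.hom h, τ₂.incl P.obj, ((τ₂.ses P.obj).exact.lift_f _ h).symm⟩
  · rintro ⟨x, y, h⟩
    rw [h, Category.assoc, τ₂.hom_eq_zero (τ₂.tors_t _) (τ₂.free_f _) (y ≫ τ₂.proj P.obj),
      comp_zero]

lemma endRingHom_tCore_eq_zero_iff (I : τ₂.free.FullSubcategory) (a : End I) :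
    endRingHom (tCore τ₁ τ₂) I a = 0 ↔
      ∃ (x : I.obj ⟶ τ₁.f I.obj) (y : τ₁.f I.obj ⟶ I.obj), a.hom = x ≫ y := by
  have key : endRingHom (tCore τ₁ τ₂) I a = 0 ↔ τ₁.incl I.obj ≫ a.hom = 0 := by
    have h : ((tCore τ₁ τ₂).map a).hom ≫ fromCore τ₁ τ₂ I = τ₁.incl I.obj ≫ a.hom :=
      tCore_map_fromCore τ₁ τ₂ a
    rw [← h]
    constructor
    · intro h0
      have h0 : (tCore τ₁ τ₂).map a = 0 := h0
      rw [h0]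
      exact zero_comp
    · intro h0
      refine ObjectProperty.hom_ext _ ?_
      rw [← cancel_mono (fromCore τ₁ τ₂ I)]
      exact h0.trans zero_comp.symm
  rw [key]
  constructor
  · intro h
    exact ⟨τ₁.proj I.obj, (τ₁.ses I.obj).exact.desc a.hom h, ((τ₁.ses I.obj).exact.g_desc _ h).symm⟩
  · rintro ⟨x, y, h⟩
    rw [h, ← Category.assoc, τ₁.hom_eq_zero (τ₁.tors_t _) (τ₁.free_f _) (τ₁.incl I.obj ≫ x),
      zero_comp]

/-- The inclusion of torsion classes puts `t₂ P` into `T₁`. So `P ⟶ f₂ P` is a deflation of `T₁`,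
along which `P ⟶ f₂ P ⟶ f₂ P` lifts to an endomorphism of `P`. -/
lemma endRingHom_fCore_surjective (h : τ₂.tors ≤ τ₁.tors) {P : τ₁.tors.FullSubcategory}
    (hP : IsProj (confl τ₁.tors) P) : Function.Surjective (endRingHom (fCore τ₁ τ₂) P) := by
  intro b
  let S : ShortComplex τ₁.tors.FullSubcategory :=
    ShortComplex.mk (X₁ := ⟨_, h _ (τ₂.tors_t P.obj)⟩) (X₂ := P)
      (X₃ := ⟨_, (core_f τ₁ τ₂ P.property).1⟩)
      (ObjectProperty.homMk (τ₂.incl P.obj)) (ObjectProperty.homMk (τ₂.proj P.obj))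
      (ObjectProperty.hom_ext _ (τ₂.incl_proj P.obj))
  obtain ⟨a, ha⟩ := hP S (τ₂.ses P.obj) (ObjectProperty.homMk (toCore τ₁ τ₂ P ≫ b.hom))
  have ha : a.hom ≫ toCore τ₁ τ₂ P = toCore τ₁ τ₂ P ≫ b.hom := congrArg (fun f => f.hom) ha
  refine ⟨a, ObjectProperty.hom_ext _ ?_⟩
  rw [← cancel_epi (toCore τ₁ τ₂ P), ← ha]
  exact toCore_fCore_map τ₁ τ₂ a

/-- The inclusion of torsion classes reverses to `F₁ ⊆ F₂`. So `t₁ I ⟶ I` is an inflation of `F₂`,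
along which morphisms to `I` extend. -/
lemma endRingHom_tCore_surjective (h : τ₂.tors ≤ τ₁.tors) {I : τ₂.free.FullSubcategory}
    (hI : IsInj (confl τ₂.free) I) : Function.Surjective (endRingHom (tCore τ₁ τ₂) I) := by
  intro b
  let S : ShortComplex τ₂.free.FullSubcategory :=
    ShortComplex.mk (X₁ := ⟨_, (core_t τ₁ τ₂ I.property).2⟩) (X₂ := I)
      (X₃ := ⟨τ₁.f I.obj, (τ₂.free_iff _).2
        fun X hX a => τ₁.hom_eq_zero (h _ hX) (τ₁.free_f I.obj) a⟩)
      (ObjectProperty.homMk (τ₁.incl I.obj)) (ObjectProperty.homMk (τ₁.proj I.obj))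
      (ObjectProperty.hom_ext _ (τ₁.incl_proj I.obj))
  obtain ⟨a, ha⟩ := hI S (τ₁.ses I.obj) (ObjectProperty.homMk (b.hom ≫ fromCore τ₁ τ₂ I))
  have ha : fromCore τ₁ τ₂ I ≫ a.hom = b.hom ≫ fromCore τ₁ τ₂ I := congrArg (fun f => f.hom) ha
  refine ⟨a, ObjectProperty.hom_ext _ ?_⟩
  rw [← cancel_mono (fromCore τ₁ τ₂ I), ← ha]
  exact tCore_map_fromCore τ₁ τ₂ a

lemma endConj_injective {E : Type u} [Category.{v} E] [Preadditive E] {X Y : E} (e : X ≅ Y)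
    (a : End X) : endConj e a = 0 ↔ a = 0 := by
  refine ⟨fun h => ?_, fun h => by rw [h, map_zero]⟩
  have h : e.inv ≫ (show X ⟶ X from a) ≫ e.hom = 0 := h
  rw [← Category.assoc, Preadditive.IsIso.comp_right_eq_zero,
    Preadditive.IsIso.comp_left_eq_zero] at h
  exact h

lemma endConj_surjective {E : Type u} [Category.{v} E] [Preadditive E] {X Y : E} (e : X ≅ Y) :
    Function.Surjective (endConj e) := fun b =>
  ⟨(e.hom ≫ (show Y ⟶ Y from b) ≫ e.inv : X ⟶ X), by
    change e.inv ≫ (e.hom ≫ (show Y ⟶ Y from b) ≫ e.inv) ≫ e.hom = _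
    simp⟩

end Core

end TorsionFrob

namespace TorsionFrob

open Opposite

/-! ### Exactness of functors to abelian groups, tested on elements -/

section Functors

variable {J : Type u} [Category.{v} J]

lemma jointlyReflectIsomorphisms_evaluation :
    JointlyReflectIsomorphisms (fun Z : J => (evaluation J AddCommGrpCat.{w}).obj Z) :=
  ⟨fun f h => by
    rw [NatTrans.isIso_iff_isIso_app]
    exact h⟩

lemma functor_exact_iff (S : ShortComplex (J ⥤ AddCommGrpCat.{w})) :
    S.Exact ↔ ∀ (Z : J) (z : S.X₂.obj Z), S.g.app Z z = 0 → ∃ y, S.f.app Z y = z := by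
  refine (jointlyReflectIsomorphisms_evaluation.exact_iff S).trans ?_
  exact forall_congr' fun Z => ShortComplex.ab_exact_iff _

lemma functor_epi_iff {F G : J ⥤ AddCommGrpCat.{w}} (φ : F ⟶ G) :
    Epi φ ↔ ∀ (Z : J) (z : G.obj Z), ∃ y, φ.app Z y = z := by
  rw [NatTrans.epi_iff_epi_app]
  exact forall_congr' fun Z => AddCommGrpCat.epi_iff_surjective _

lemma functor_mono_iff {F G : J ⥤ AddCommGrpCat.{w}} (φ : F ⟶ G) :
    Mono φ ↔ ∀ (Z : J) (z : F.obj Z), φ.app Z z = 0 → z = 0 := by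
  rw [NatTrans.mono_iff_mono_app]
  refine forall_congr' fun Z => ?_
  rw [AddCommGrpCat.mono_iff_injective]
  exact injective_iff_map_eq_zero (φ.app Z).hom

lemma map_comp_apply (F : J ⥤ AddCommGrpCat.{w}) {X Y Z : J} (f : X ⟶ Y) (g : Y ⟶ Z)
    (x : F.obj X) : F.map (f ≫ g) x = F.map g (F.map f x) := by
  rw [F.map_comp]; rfl

lemma app_map_apply {F G : J ⥤ AddCommGrpCat.{w}} (φ : F ⟶ G) {X Y : J} (f : X ⟶ Y)
    (x : F.obj X) : φ.app Y (F.map f x) = G.map f (φ.app X x) :=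
  ConcreteCategory.congr_hom (φ.naturality f) x

end Functors

section Elements

variable {E : Type u} [Category.{v} E]

/-- The restriction of `x ∈ F Y` along `g : Z ⟶ Y`, for a presheaf `F`. -/
abbrev res (F : Eᵒᵖ ⥤ AddCommGrpCat.{v}) {Y Z : E} (g : Z ⟶ Y) (x : F.obj (op Y)) : F.obj (op Z) :=
  F.map g.op x

lemma res_comp (F : Eᵒᵖ ⥤ AddCommGrpCat.{v}) {Y Z W : E} (h : W ⟶ Z) (g : Z ⟶ Y)
    (x : F.obj (op Y)) : res F (h ≫ g) x = res F h (res F g x) :=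
  map_comp_apply F g.op h.op x

lemma res_id (F : Eᵒᵖ ⥤ AddCommGrpCat.{v}) {Y : E} (x : F.obj (op Y)) : res F (𝟙 Y) x = x := by
  change F.map (𝟙 _) x = x
  rw [F.map_id]; rfl

lemma app_res {F G : Eᵒᵖ ⥤ AddCommGrpCat.{v}} (φ : F ⟶ G) {Y Z : E} (g : Z ⟶ Y)
    (x : F.obj (op Y)) : φ.app (op Z) (res F g x) = res G g (φ.app (op Y) x) :=
  app_map_apply φ g.op x

end Elements

/-! ### Closure properties of finitely presented functors -/

section ModCat

variable {E : Type u} [Category.{v} E] [Preadditive E]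

lemma res_add_left (F : Eᵒᵖ ⥤ AddCommGrpCat.{v}) [F.Additive] {Y Z : E} (g g' : Z ⟶ Y)
    (x : F.obj (op Y)) : res F (g + g') x = res F g x + res F g' x := by
  change F.map (g.op + g'.op) x = _
  rw [F.map_add]; rfl

lemma res_zero_left (F : Eᵒᵖ ⥤ AddCommGrpCat.{v}) [F.Additive] {Y Z : E}
    (x : F.obj (op Y)) : res F (0 : Z ⟶ Y) x = 0 := by
  change F.map 0 x = _
  rw [F.map_zero]; rfl

lemma res_sub_left (F : Eᵒᵖ ⥤ AddCommGrpCat.{v}) [F.Additive] {Y Z : E} (g g' : Z ⟶ Y)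
    (x : F.obj (op Y)) : res F (g - g') x = res F g x - res F g' x := by
  change F.map (g.op - g'.op) x = _
  rw [F.map_sub]; rfl

/-- The Yoneda lemma: the morphism from a representable functor given by an element. -/
def yo (F : Eᵒᵖ ⥤ AddCommGrpCat.{v}) [F.Additive] {Y : E} (x : F.obj (op Y)) :
    preadditiveYoneda.obj Y ⟶ F where
  app Z := AddCommGrpCat.ofHom
    { toFun := fun g => res F (show Z.unop ⟶ Y from g) x
      map_zero' := res_zero_left F x
      map_add' := fun g g' => res_add_left F _ _ x }
  naturality {Z W} h := by
    ext g
    exact res_comp F h.unop (show Z.unop ⟶ Y from g) x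

/-- The element given by a morphism from a representable functor. -/
def elt {F : Eᵒᵖ ⥤ AddCommGrpCat.{v}} {Y : E} (φ : preadditiveYoneda.obj Y ⟶ F) : F.obj (op Y) :=
  φ.app (op Y) (show (preadditiveYoneda.obj Y).obj (op Y) from 𝟙 Y)

lemma app_eq_res_elt {F : Eᵒᵖ ⥤ AddCommGrpCat.{v}} {Y Z : E} (φ : preadditiveYoneda.obj Y ⟶ F)
    (g : Z ⟶ Y) :
    φ.app (op Z) (show (preadditiveYoneda.obj Y).obj (op Z) from g) = res F g (elt φ) := by
  rw [elt, ← app_res]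
  congr 1
  exact (Category.comp_id g).symm

lemma hom_ext_elt {F : Eᵒᵖ ⥤ AddCommGrpCat.{v}} {Y : E} {φ ψ : preadditiveYoneda.obj Y ⟶ F}
    (h : elt φ = elt ψ) : φ = ψ := by
  ext Z g
  exact (app_eq_res_elt (Z := Z.unop) φ g).trans
    ((congrArg (fun x => res F (show Z.unop ⟶ Y from g) x) h).trans
      (app_eq_res_elt (Z := Z.unop) ψ g).symm)

lemma elt_yo (F : Eᵒᵖ ⥤ AddCommGrpCat.{v}) [F.Additive] {Y : E} (x : F.obj (op Y)) :
    elt (yo F x) = x := res_id F x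

/-- A presentation of `F` by representable functors, in terms of elements. -/
structure IsPresentation (F : Eᵒᵖ ⥤ AddCommGrpCat.{v}) {X Y : E} (f : X ⟶ Y) (x : F.obj (op Y)) :
    Prop where
  gen : ∀ {Z : E} (z : F.obj (op Z)), ∃ g : Z ⟶ Y, res F g x = z
  rel : ∀ {Z : E} (g : Z ⟶ Y), res F g x = 0 ↔ ∃ h : Z ⟶ X, h ≫ f = g

/-- By the Yoneda lemma a presentation is a generator `x` together with a morphism `f` through which
exactly the relations on `x` factor. The closure properties are proved in this language. -/
lemma isFinPres_iff (F : Eᵒᵖ ⥤ AddCommGrpCat.{v}) :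
    IsFinPres F ↔ F.Additive ∧ ∃ (X Y : E) (f : X ⟶ Y) (x : F.obj (op Y)), IsPresentation F f x := by
  refine and_congr_right fun hF => ⟨?_, ?_⟩
  · rintro ⟨X, Y, f, p, w, ⟨h⟩⟩
    have hex : (ShortComplex.mk _ _ w).Exact := ShortComplex.exact_of_g_is_cokernel _ h
    have : Epi p := epi_of_isColimit_cofork h
    rw [functor_exact_iff] at hex
    refine ⟨X, Y, f, elt p, ⟨fun {Z} z => ?_, fun {Z} g => ⟨fun hg => ?_, ?_⟩⟩⟩
    · obtain ⟨g, hg⟩ := (functor_epi_iff p).1 this (op Z) z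
      exact ⟨g, (app_eq_res_elt p _).symm.trans hg⟩
    · obtain ⟨h, hh⟩ := hex (op Z) g ((app_eq_res_elt p g).trans hg)
      exact ⟨h, hh⟩
    · rintro ⟨h, rfl⟩
      rw [← app_eq_res_elt]
      exact ConcreteCategory.congr_hom (congr_app w (op Z)) h
  · rintro ⟨X, Y, f, x, hx⟩
    have w : preadditiveYoneda.map f ≫ yo F x = 0 := by
      ext Z h
      exact (hx.rel (Z := Z.unop) _).2 ⟨h, rfl⟩
    have hex : (ShortComplex.mk _ _ w).Exact := by
      rw [functor_exact_iff]
      intro Z z hz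
      exact (hx.rel (Z := Z.unop) z).1 hz
    have : Epi (ShortComplex.mk _ _ w).g := by
      rw [functor_epi_iff]
      intro Z z
      exact hx.gen (Z := Z.unop) z
    exact ⟨X, Y, f, yo F x, w, ⟨hex.gIsCokernel⟩⟩

/-- Write `x` as the restriction of `p` along `a`. Then `g` annihilates `x` if and only if `g ≫ a`
factors through `f`, so `K` is the fibre product of `a` and `f`, built as a kernel on `X ⊞ P₁`. -/
lemma IsPresentation.exists_kernel [HasBinaryBiproducts E] [HasKernels E]
    {F : Eᵒᵖ ⥤ AddCommGrpCat.{v}} {P₁ P₀ : E} {f : P₁ ⟶ P₀} {p : F.obj (op P₀)}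
    (h : IsPresentation F f p) {X : E} (x : F.obj (op X)) :
    ∃ (K : E) (k : K ⟶ X), ∀ {Z : E} (g : Z ⟶ X), res F g x = 0 ↔ ∃ t : Z ⟶ K, t ≫ k = g := by
  obtain ⟨a, rfl⟩ := h.gen x
  refine ⟨kernel (biprod.desc a (-f)), kernel.ι _ ≫ biprod.fst, fun {Z} g => ?_⟩
  rw [← res_comp, h.rel]
  constructor
  · rintro ⟨s, hs⟩
    exact ⟨kernel.lift _ (biprod.lift g s) (by simp [hs]), by simp⟩
  · rintro ⟨t, rfl⟩
    refine ⟨t ≫ kernel.ι _ ≫ biprod.snd, ?_⟩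
    have h : kernel.ι (biprod.desc a (-f)) ≫ (biprod.fst ≫ a + biprod.snd ≫ (-f)) = 0 := by
      rw [← biprod.desc_eq]
      exact kernel.condition _
    rw [Preadditive.comp_add, Preadditive.comp_neg, Preadditive.comp_neg] at h
    simp only [Category.assoc]
    congr 1
    exact (eq_of_sub_eq_zero ((sub_eq_add_neg _ _).trans h)).symm

lemma additive_of_mono {F G : Eᵒᵖ ⥤ AddCommGrpCat.{v}} [G.Additive] (φ : F ⟶ G) [Mono φ] :
    F.Additive where
  map_add {X Y f g} := by
    have := (NatTrans.mono_iff_mono_app φ).1 inferInstance Y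
    rw [← cancel_mono (φ.app Y), Preadditive.add_comp, φ.naturality, φ.naturality, φ.naturality,
      G.map_add, Preadditive.comp_add]

lemma additive_of_epi {F G : Eᵒᵖ ⥤ AddCommGrpCat.{v}} [F.Additive] (φ : F ⟶ G) [Epi φ] :
    G.Additive where
  map_add {X Y f g} := by
    have := (NatTrans.epi_iff_epi_app φ).1 inferInstance X
    rw [← cancel_epi (φ.app X), Preadditive.comp_add, ← φ.naturality, ← φ.naturality,
      ← φ.naturality, F.map_add, Preadditive.add_comp]

instance : (IsFinPres (E := E)).IsClosedUnderIsomorphisms where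
  of_iso {F G} e hF := by
    obtain ⟨hF, X, Y, f, p, w, ⟨h⟩⟩ := hF
    refine ⟨additive_of_epi e.hom, X, Y, f, p ≫ e.hom, by rw [reassoc_of% w, zero_comp], ⟨?_⟩⟩
    exact IsColimit.ofIsoColimit h (Cofork.ext e rfl)

instance [HasBinaryBiproducts E] [HasKernels E] : (IsFinPres (E := E)).IsClosedUnderKernels where
  kernels_le := by
    rintro _ ⟨φ, c, hc, hF, hG⟩
    rename_i F G
    rw [isFinPres_iff] at hF hG ⊢
    obtain ⟨_, P₁, P₀, f, p, hp⟩ := hF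
    obtain ⟨_, Q₁, Q₀, g, q, hq⟩ := hG
    have : Mono c.ι := Fork.IsLimit.mono hc
    have hm := (functor_mono_iff c.ι).1 this
    have hex : (ShortComplex.mk c.ι φ c.condition).Exact :=
      ShortComplex.exact_of_f_is_kernel _ (IsLimit.ofIsoLimit hc (Fork.ext (Iso.refl _) (by simp)))
    rw [functor_exact_iff] at hex
    have hzero : ∀ {Z : E} (z : c.pt.obj (op Z)), φ.app _ (c.ι.app _ z) = 0 := fun z =>
      ConcreteCategory.congr_hom (congrArg (fun α => α.app _) c.condition) z
    refine ⟨additive_of_mono c.ι, ?_⟩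
    -- `K₀` parametrizes the multiples of the generator `p` that die in `G`, and `K₁` the relations
    -- in `F` on the restriction of `p` to `K₀`.
    obtain ⟨K₀, k₀, h₀⟩ := hq.exists_kernel (φ.app _ p)
    obtain ⟨K₁, k₁, h₁⟩ := hp.exists_kernel (res F k₀ p)
    obtain ⟨x, hx⟩ := hex (op K₀) (res F k₀ p)
      ((app_res φ k₀ p).trans ((h₀ k₀).2 ⟨𝟙 _, Category.id_comp _⟩))
    have hx : c.ι.app _ x = res F k₀ p := hx
    refine ⟨K₁, K₀, k₁, x, ⟨fun {Z} z => ?_, fun {Z} t => ?_⟩⟩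
    · obtain ⟨a, ha⟩ := hp.gen (c.ι.app _ z)
      obtain ⟨b, rfl⟩ := (h₀ a).1 (by
        have := hzero z
        rw [← ha, app_res] at this
        exact this)
      refine ⟨b, ?_⟩
      rw [← sub_eq_zero]
      apply hm
      have : c.ι.app _ (res c.pt b x) = c.ι.app _ z := by
        rw [← ha, app_res, hx, res_comp]
      exact (map_sub _ _ _).trans (sub_eq_zero.2 this)
    · rw [← h₁, ← hx, ← app_res]
      exact ⟨fun h => (congrArg _ h).trans (map_zero _), fun h => hm _ _ h⟩

instance [HasBinaryBiproducts E] : (IsFinPres (E := E)).IsClosedUnderCokernels where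
  cokernels_le := by
    rintro _ ⟨φ, c, hc, hF, hG⟩
    rename_i F G
    rw [isFinPres_iff] at hF hG ⊢
    obtain ⟨_, P₁, P₀, f, p, hp⟩ := hF
    obtain ⟨_, Q₁, Q₀, g, q, hq⟩ := hG
    have : Epi c.π := Cofork.IsColimit.epi hc
    have hm := (functor_epi_iff c.π).1 this
    have hex : (ShortComplex.mk φ c.π c.condition).Exact :=
      ShortComplex.exact_of_g_is_cokernel _
        (IsColimit.ofIsoColimit hc (Cofork.ext (Iso.refl _) (by simp)))
    rw [functor_exact_iff] at hex
    have hzero : ∀ {Z : E} (z : F.obj (op Z)), c.π.app _ (φ.app _ z) = 0 := fun z =>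
      ConcreteCategory.congr_hom (congrArg (fun α => α.app _) c.condition) z
    have hadd : c.pt.Additive := additive_of_epi c.π
    refine ⟨hadd, ?_⟩
    obtain ⟨a, ha⟩ := hq.gen (φ.app _ p)
    -- The cokernel has the generator of `G`; its relations are those of `G` together with the image
    -- of the generator of `F`, expressed through `a`.
    refine ⟨P₀ ⊞ Q₁, Q₀, biprod.desc a g, c.π.app _ q, ⟨fun {Z} z => ?_, fun {Z} t => ⟨?_, ?_⟩⟩⟩
    · obtain ⟨y, rfl⟩ := hm _ z
      obtain ⟨t, rfl⟩ := hq.gen y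
      exact ⟨t, (app_res c.π t q).symm⟩
    · intro ht
      rw [← app_res] at ht
      obtain ⟨y, hy⟩ := hex _ _ ht
      have hy : φ.app _ y = res G t q := hy
      obtain ⟨b, rfl⟩ := hp.gen y
      rw [app_res, ← ha, ← res_comp, ← sub_eq_zero, ← res_sub_left, hq.rel] at hy
      obtain ⟨s, hs⟩ := hy
      exact ⟨biprod.lift b (-s), by simp [hs]⟩
    · rintro ⟨s, rfl⟩
      have h₁ : res G ((s ≫ biprod.fst) ≫ a) q = φ.app _ (res F (s ≫ biprod.fst) p) := by
        rw [res_comp, ha, app_res]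
      have h₂ : res G ((s ≫ biprod.snd) ≫ g) q = 0 := (hq.rel _).2 ⟨_, rfl⟩
      rw [biprod.desc_eq, Preadditive.comp_add, ← Category.assoc, ← Category.assoc, ← app_res,
        res_add_left, h₁, h₂, add_zero, hzero]

lemma isFinPres_yoneda [HasZeroObject E] (Y : E) : IsFinPres (preadditiveYoneda.obj Y) := by
  rw [isFinPres_iff]
  refine ⟨inferInstance, 0, Y, 0, (𝟙 Y : Y ⟶ Y), ⟨fun {Z} z => ⟨z, Category.comp_id _⟩,
    fun {Z} g => ?_⟩⟩
  have : res (preadditiveYoneda.obj Y) g (show (preadditiveYoneda.obj Y).obj (op Y) from 𝟙 Y) =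
    (show (preadditiveYoneda.obj Y).obj (op Z) from g) := Category.comp_id g
  rw [this]
  exact ⟨fun h => ⟨0, comp_zero.trans (Eq.symm h)⟩, fun ⟨t, ht⟩ => ht.symm.trans comp_zero⟩

instance [HasZeroObject E] : (IsFinPres (E := E)).ContainsZero :=
  ⟨⟨_, (Functor.isZero_iff _).2 fun X => by
    refine AddCommGrpCat.isZero_of_iff_subsingleton.2 ⟨fun a b => ?_⟩
    exact (isZero_zero E).eq_of_tgt (show X.unop ⟶ 0 from a) b, isFinPres_yoneda (0 : E)⟩⟩

lemma isFinPres_biprod [HasBinaryBiproducts E] {F G : Eᵒᵖ ⥤ AddCommGrpCat.{v}} (hF : IsFinPres F)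
    (hG : IsFinPres G) : IsFinPres (F ⊞ G) := by
  rw [isFinPres_iff] at hF hG ⊢
  obtain ⟨_, P₁, P₀, f, p, hp⟩ := hF
  obtain ⟨_, Q₁, Q₀, g, q, hq⟩ := hG
  let i₁ : F ⟶ F ⊞ G := biprod.inl
  let i₂ : G ⟶ F ⊞ G := biprod.inr
  let p₁ : F ⊞ G ⟶ F := biprod.fst
  let p₂ : F ⊞ G ⟶ G := biprod.snd
  have e₁ : ∀ Z x, p₁.app Z (i₁.app Z x) = x := fun Z x =>
    ConcreteCategory.congr_hom (congrArg (fun α => α.app Z) (biprod.inl_fst (X := F) (Y := G))) x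
  have e₂ : ∀ Z x, p₂.app Z (i₂.app Z x) = x := fun Z x =>
    ConcreteCategory.congr_hom (congrArg (fun α => α.app Z) (biprod.inr_snd (X := F) (Y := G))) x
  have e₃ : ∀ Z x, p₂.app Z (i₁.app Z x) = 0 := fun Z x =>
    ConcreteCategory.congr_hom (congrArg (fun α => α.app Z) (biprod.inl_snd (X := F) (Y := G))) x
  have e₄ : ∀ Z x, p₁.app Z (i₂.app Z x) = 0 := fun Z x =>
    ConcreteCategory.congr_hom (congrArg (fun α => α.app Z) (biprod.inr_fst (X := F) (Y := G))) x
  have e₅ : ∀ Z x, i₁.app Z (p₁.app Z x) + i₂.app Z (p₂.app Z x) = x := fun Z x =>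
    ConcreteCategory.congr_hom (congrArg (fun α => α.app Z) (biprod.total (X := F) (Y := G))) x
  have hext : ∀ {Z} (x y : (F ⊞ G).obj Z), p₁.app Z x = p₁.app Z y → p₂.app Z x = p₂.app Z y →
      x = y := fun x y h₁ h₂ => by rw [← e₅ _ x, ← e₅ _ y, h₁, h₂]
  have hadd : (F ⊞ G).Additive := ⟨fun {X Y a b} => by
    ext x
    refine hext _ _ ?_ ?_
    · refine (app_map_apply p₁ (a + b) x).trans ?_
      rw [F.map_add]
      exact ((map_add (p₁.app Y).hom _ _).trans
        (congrArg₂ _ (app_map_apply p₁ a x) (app_map_apply p₁ b x))).symm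
    · refine (app_map_apply p₂ (a + b) x).trans ?_
      rw [G.map_add]
      exact ((map_add (p₂.app Y).hom _ _).trans
        (congrArg₂ _ (app_map_apply p₂ a x) (app_map_apply p₂ b x))).symm⟩
  let x : (F ⊞ G).obj (op (P₀ ⊞ Q₀)) :=
    i₁.app _ (res F biprod.fst p) + i₂.app _ (res G biprod.snd q)
  have hx₁ : p₁.app _ x = res F biprod.fst p :=
    (map_add (p₁.app _).hom _ _).trans ((congrArg₂ _ (e₁ _ _) (e₄ _ _)).trans (add_zero _))
  have hx₂ : p₂.app _ x = res G biprod.snd q :=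
    (map_add (p₂.app _).hom _ _).trans ((congrArg₂ _ (e₃ _ _) (e₂ _ _)).trans (zero_add _))
  have hr₁ : ∀ {Z : E} (t : Z ⟶ P₀ ⊞ Q₀), p₁.app _ (res _ t x) = res F (t ≫ biprod.fst) p :=
    fun t => by rw [app_res, hx₁, res_comp]
  have hr₂ : ∀ {Z : E} (t : Z ⟶ P₀ ⊞ Q₀), p₂.app _ (res _ t x) = res G (t ≫ biprod.snd) q :=
    fun t => by rw [app_res, hx₂, res_comp]
  refine ⟨hadd, P₁ ⊞ Q₁, P₀ ⊞ Q₀, biprod.map f g, x, ⟨fun {Z} z => ?_, fun {Z} t => ⟨?_, ?_⟩⟩⟩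
  · obtain ⟨a, ha⟩ := hp.gen (p₁.app _ z)
    obtain ⟨b, hb⟩ := hq.gen (p₂.app _ z)
    refine ⟨biprod.lift a b, hext _ _ ?_ ?_⟩
    · rw [hr₁, biprod.lift_fst, ha]
    · rw [hr₂, biprod.lift_snd, hb]
  · intro h
    obtain ⟨a, ha⟩ := (hp.rel (t ≫ biprod.fst)).1
      (by rw [← hr₁, h]; exact map_zero (p₁.app _).hom)
    obtain ⟨b, hb⟩ := (hq.rel (t ≫ biprod.snd)).1
      (by rw [← hr₂, h]; exact map_zero (p₂.app _).hom)
    exact ⟨biprod.lift a b, by ext <;> simp [ha, hb]⟩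
  · rintro ⟨s, rfl⟩
    refine hext _ _ ?_ ?_
    · rw [hr₁]
      exact ((hp.rel _).2 ⟨s ≫ biprod.fst, by simp⟩).trans (map_zero (p₁.app _).hom).symm
    · rw [hr₂]
      exact ((hq.rel _).2 ⟨s ≫ biprod.snd, by simp⟩).trans (map_zero (p₂.app _).hom).symm

instance [HasBinaryBiproducts E] [HasZeroObject E] :
    (IsFinPres (E := E)).IsClosedUnderFiniteProducts := by
  have : (IsFinPres (E := E)).IsClosedUnderBinaryProducts := ⟨by
    rintro X ⟨p⟩
    let e : X ≅ p.diag.obj ⟨.left⟩ ⊞ p.diag.obj ⟨.right⟩ :=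
      IsLimit.conePointsIsoOfNatIso p.isLimit (BinaryBiproduct.isLimit _ _)
        (mapPairIso (Iso.refl _) (Iso.refl _))
    exact (IsFinPres (E := E)).prop_of_iso e.symm
      (isFinPres_biprod (p.prop_diag_obj _) (p.prop_diag_obj _))⟩
  exact ObjectProperty.IsClosedUnderFiniteProducts.mk'

end ModCat

end TorsionFrob

namespace TorsionFrob

open Opposite

/-! ### The global dimension of `mod E` -/

section GlobalDim

variable {E : Type u} [Category.{v} E] [Preadditive E] [HasBinaryBiproducts E] [HasZeroObject E]

/-- The representable functor, as an object of `mod E`. -/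
def rep (Y : E) : ModCat E := ⟨preadditiveYoneda.obj Y, isFinPres_yoneda Y⟩

/-- The inclusion of `mod E` into all functors preserves and reflects epimorphisms, so they can be
tested pointwise. -/
lemma modCat_epi_iff {F G : ModCat E} (φ : F ⟶ G) :
    Epi φ ↔ ∀ (Z : Eᵒᵖ) (z : G.obj.obj Z), ∃ y, φ.hom.app Z y = z := by
  rw [← functor_epi_iff]
  have := (IsFinPres (E := E)).preservesEpimorphisms_ι_of_isNormalMonoCategory
  exact ⟨fun _ => inferInstanceAs (Epi (IsFinPres.ι.map φ)), fun h => IsFinPres.ι.epi_of_epi_map h⟩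

variable [HasKernels E]

lemma modCat_shortExact {S : ShortComplex (ModCat E)}
    (h₁ : ∀ (Z : Eᵒᵖ) (z : S.X₁.obj.obj Z), S.f.hom.app Z z = 0 → z = 0)
    (h₂ : ∀ (Z : Eᵒᵖ) (z : S.X₂.obj.obj Z), S.g.hom.app Z z = 0 → ∃ y, S.f.hom.app Z y = z)
    (h₃ : ∀ (Z : Eᵒᵖ) (z : S.X₃.obj.obj Z), ∃ y, S.g.hom.app Z y = z) : S.ShortExact :=
  ShortExact.reflects_shortExact_of_faithful (IsFinPres (E := E)).ι
    (ShortComplex.ShortExact.mk' ((functor_exact_iff _).2 h₂) ((functor_mono_iff _).2 h₁)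
      ((functor_epi_iff _).2 h₃))

instance (Y : E) : Projective (rep Y) where
  factors {F G} f e he := by
    have := F.property.1
    obtain ⟨y, hy⟩ := (modCat_epi_iff e).1 he (op Y) (elt f.hom)
    refine ⟨ObjectProperty.homMk (yo F.obj y), ObjectProperty.hom_ext _ (hom_ext_elt ?_)⟩
    exact (congrArg (e.hom.app _) (elt_yo F.obj y)).trans hy

/-- If `E` has kernels, then `mod E` is abelian of global dimension at most two. -/
theorem isAbelianOfGlobalDimLE_modCat : IsAbelianOfGlobalDimLE (ModCat E) 2 := by
  refine ⟨inferInstance, rfl, fun M => ?_⟩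
  obtain ⟨hM, X, Y, f, x, hx⟩ := (isFinPres_iff M.obj).1 M.property
  let p : rep Y ⟶ M := ObjectProperty.homMk (yo M.obj x)
  let S : ShortComplex (ModCat E) := ShortComplex.mk (kernel.ι p) p (kernel.condition p)
  have hp : Epi p := (modCat_epi_iff p).2 fun Z z => hx.gen (Z := Z.unop) z
  have hS : S.ShortExact := ShortComplex.ShortExact.mk' (ShortComplex.exact_kernel p)
    (inferInstanceAs (Mono (kernel.ι p))) hp
  let a : rep X ⟶ rep Y := ObjectProperty.homMk (preadditiveYoneda.map f)
  have ha : a ≫ p = 0 := by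
    ext Z h
    exact (hx.rel (Z := Z.unop) _).2 ⟨h, rfl⟩
  let q : rep X ⟶ kernel p := kernel.lift p a ha
  have hq : q ≫ kernel.ι p = a := kernel.lift_ι _ _ _
  have hq' : ∀ (Z : Eᵒᵖ) z, (kernel.ι p).hom.app Z (q.hom.app Z z) = a.hom.app Z z := fun Z z =>
    ConcreteCategory.congr_hom (congr_app (congrArg (fun α => α.hom) hq) Z) z
  have hp' : ∀ (Z : Eᵒᵖ) z, p.hom.app Z ((kernel.ι p).hom.app Z z) = 0 := fun Z z =>
    ConcreteCategory.congr_hom (congr_app (congrArg (fun α => α.hom) (kernel.condition p)) Z) z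
  have hm : ∀ (Z : Eᵒᵖ) z, (kernel.ι p).hom.app Z z = 0 → z = 0 := by
    have := (IsFinPres (E := E)).preservesMonomorphisms_ι_of_isNormalEpiCategory
    exact (functor_mono_iff (kernel.ι p).hom).1
      (inferInstanceAs (Mono (IsFinPres.ι.map (kernel.ι p))))
  -- Since `E` has kernels, the kernel of `q` is itself representable, by `kernel f`.
  let b : rep (kernel f) ⟶ rep X := ObjectProperty.homMk (preadditiveYoneda.map (kernel.ι f))
  have hb : b ≫ q = 0 := by
    rw [← cancel_mono (kernel.ι p), Category.assoc, hq, zero_comp]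
    refine ObjectProperty.hom_ext _ ((preadditiveYoneda.map_comp _ _).symm.trans ?_)
    rw [kernel.condition, Functor.map_zero]
    rfl
  let S' : ShortComplex (ModCat E) := ShortComplex.mk b q hb
  have hS' : S'.ShortExact := by
    refine modCat_shortExact (fun Z z hz => ?_) (fun Z z hz => ?_) (fun Z z => ?_)
    · have hz : (show Z.unop ⟶ kernel f from z) ≫ kernel.ι f = 0 := hz
      exact (cancel_mono (kernel.ι f)).1 (hz.trans zero_comp.symm)
    · have h : (show Z.unop ⟶ X from z) ≫ f = 0 :=
        (hq' Z z).symm.trans ((congrArg _ hz).trans (map_zero ((kernel.ι p).hom.app Z).hom))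
      exact ⟨kernel.lift f _ h, kernel.lift_ι f _ h⟩
    · obtain ⟨h, hh⟩ := (hx.rel (Z := Z.unop) ((kernel.ι p).hom.app Z z)).1 (hp' Z z)
      refine ⟨h, ?_⟩
      rw [← sub_eq_zero]
      apply hm
      refine (map_sub ((kernel.ι p).hom.app Z).hom _ _).trans (sub_eq_zero.2 ?_)
      exact (hq' Z h).trans hh
  -- The bounds are strict: the kernel has projective dimension at most one, and hence `M` at most
  -- two.
  have h₁ : HasProjectiveDimensionLT (kernel p) 2 :=
    hS'.hasProjectiveDimensionLT_X₃ 1 (inferInstanceAs (HasProjectiveDimensionLT (rep _) 1))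
      (inferInstanceAs (HasProjectiveDimensionLT (rep _) (1 + 1)))
  exact hS.hasProjectiveDimensionLT_X₃ 2 h₁
    (inferInstanceAs (HasProjectiveDimensionLT (rep _) (1 + 2)))

end GlobalDim

section Core

variable {A : Type u} [Category.{v} A] [Abelian A] (τ₁ τ₂ : TorsionPair A)

theorem isAbelianOfGlobalDimLE_modCat_core :
    IsAbelianOfGlobalDimLE (ModCat (core τ₁ τ₂).FullSubcategory) 2 :=
  have := hasBinaryBiproducts_of_finite_biproducts (core τ₁ τ₂).FullSubcategory
  isAbelianOfGlobalDimLE_modCat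

theorem isAbelianOfGlobalDimLE_modCat_core_op :
    IsAbelianOfGlobalDimLE (ModCat (core τ₁ τ₂).FullSubcategoryᵒᵖ) 2 :=
  have := hasBinaryBiproducts_of_finite_biproducts (core τ₁ τ₂).FullSubcategory
  have : HasBinaryBiproducts (core τ₁ τ₂).FullSubcategoryᵒᵖ :=
    HasBinaryBiproducts.of_hasBinaryProducts
  -- Coequalizers of `C₁₂` supply the kernels of the opposite category.
  have : HasCoequalizers (core τ₁ τ₂).FullSubcategory :=
    Preadditive.hasCoequalizers_of_hasCokernels
  isAbelianOfGlobalDimLE_modCat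

end Core

end TorsionFrob

namespace TorsionFrob

/-! ### Symmetry of the vanishing of `Ext¹` -/

section ExtOne

variable {A : Type u} [Category.{v} A] [Abelian A]

/-- `Ext¹` in an extension-closed subcategory agrees with `Ext¹` in the ambient category. -/
lemma extOneVanishes_confl_iff (P : ObjectProperty A) [P.IsClosedUnderExtensions]
    (X Y : P.FullSubcategory) :
    ExtOneVanishes (confl P) X Y ↔
      ExtOneVanishes (fun S : ShortComplex A => S.ShortExact) X.obj Y.obj := by
  constructor
  · intro h M i p w hS
    obtain ⟨σ⟩ := h ⟨M, P.prop_X₂_of_shortExact hS Y.property X.property⟩ (ObjectProperty.homMk i)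
      (ObjectProperty.homMk p) (ObjectProperty.hom_ext _ w) hS
    exact ⟨σ.map P.ι⟩
  · intro h M i p w hS
    obtain ⟨σ⟩ := h M.obj i.hom p.hom (congrArg (fun f => f.hom) w) hS
    exact ⟨⟨ObjectProperty.homMk σ.r, ObjectProperty.homMk σ.s, ObjectProperty.hom_ext _ σ.f_r,
      ObjectProperty.hom_ext _ σ.s_g, ObjectProperty.hom_ext _ σ.id⟩⟩

lemma extOneSymmetric_confl (P : ObjectProperty A) [P.IsClosedUnderExtensions]
    (h : ∀ X Y : A, ExtOneVanishes (fun S : ShortComplex A => S.ShortExact) X Y →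
      ExtOneVanishes (fun S : ShortComplex A => S.ShortExact) Y X) :
    ExtOneSymmetric (confl P) := fun X Y => by
  rw [extOneVanishes_confl_iff, extOneVanishes_confl_iff]
  exact ⟨h _ _, h _ _⟩

end ExtOne

/-! ### The case of a 2-Calabi-Yau bounded derived category -/

section Derived

open Pretriangulated DerivedCategory

variable {A : Type u} [Category.{v} A] [Abelian A] [HasDerivedCategory.{w'} A]

/-- A distinguished triangle of objects concentrated in degree zero is a short exact sequence. -/
lemma shortExact_of_distTriang {X Y Z : A} (i : X ⟶ Y) (p : Y ⟶ Z) (w : i ≫ p = 0)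
    (α : (singleFunctor A 0).obj Z ⟶ ((singleFunctor A 0).obj X)⟦(1 : ℤ)⟧)
    (h : Triangle.mk ((singleFunctor A 0).map i) ((singleFunctor A 0).map p) α ∈
      distTriang (DerivedCategory A)) :
    (ShortComplex.mk i p w).ShortExact := by
  let e := singleFunctorCompHomologyFunctorIso A 0
  -- In the long homology sequence the obstructions to a short exact sequence are `H⁻¹` of `Z` and
  -- `H¹` of `X`, which vanish for objects in degree zero.
  have hm : Mono ((homologyFunctor A 0).map ((singleFunctor A 0).map i)) := by
    refine (HomologySequence.mono_homologyMap_mor₁_iff _ h (-1) 0 (by lia)).2 ?_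
    exact ((isGE_iff ((singleFunctor A 0).obj Z) 0).1 inferInstance (-1) (by lia)).eq_of_src _ _
  have he : Epi ((homologyFunctor A 0).map ((singleFunctor A 0).map p)) := by
    refine (HomologySequence.epi_homologyMap_mor₂_iff _ h 0 1 (by lia)).2 ?_
    exact ((isLE_iff ((singleFunctor A 0).obj X) 0).1 inferInstance 1 (by lia)).eq_of_tgt _ _
  have hex := HomologySequence.exact₂ _ h 0
  refine ShortComplex.shortExact_of_iso ?_ (ShortComplex.ShortExact.mk' hex hm he)
  exact ShortComplex.isoMk (e.app X) (e.app Y) (e.app Z) (e.hom.naturality i).symm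
    (e.hom.naturality p).symm

/-- `Ext¹(X, Y)` vanishes if and only if there are no nonzero morphisms `X ⟶ Y⟦1⟧` in the derived
category. -/
lemma extOneVanishes_iff_derived (X Y : A) :
    ExtOneVanishes (fun S : ShortComplex A => S.ShortExact) X Y ↔
      ∀ α : (singleFunctor A 0).obj X ⟶ ((singleFunctor A 0).obj Y)⟦(1 : ℤ)⟧, α = 0 := by
  constructor
  · intro h α
    obtain ⟨E, f, g, hT⟩ := distinguished_cocone_triangle₂ α
    -- The middle term of a triangle on `α` lies in the heart with its neighbours, so it comes from
    -- an object `M`, and `α` becomes the class of an extension.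
    have : E.IsLE 0 := TStructure.t.isLE₂ _ hT 0
      (inferInstanceAs (((singleFunctor A 0).obj Y).IsLE 0))
      (inferInstanceAs (((singleFunctor A 0).obj X).IsLE 0))
    have : E.IsGE 0 := TStructure.t.isGE₂ _ hT 0
      (inferInstanceAs (((singleFunctor A 0).obj Y).IsGE 0))
      (inferInstanceAs (((singleFunctor A 0).obj X).IsGE 0))
    obtain ⟨M, ⟨e⟩⟩ := E.exists_iso_singleFunctor_obj_of_isGE_of_isLE 0
    obtain ⟨i, hi⟩ := (singleFunctor A 0).map_surjective (f ≫ e.hom)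
    obtain ⟨p, hp⟩ := (singleFunctor A 0).map_surjective (e.inv ≫ g)
    have hT' : Triangle.mk ((singleFunctor A 0).map i) ((singleFunctor A 0).map p) α ∈
        distTriang (DerivedCategory A) := by
      refine isomorphic_distinguished _ hT _ (Triangle.isoMk _ _ (Iso.refl _) e.symm (Iso.refl _)
        ?_ ?_ ?_)
      · change (singleFunctor A 0).map i ≫ e.inv = 𝟙 _ ≫ f
        rw [hi, Category.assoc, e.hom_inv_id, Category.comp_id, Category.id_comp]
      · change (singleFunctor A 0).map p ≫ 𝟙 _ = e.inv ≫ g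
        rw [hp, Category.comp_id]
      · change α ≫ (shiftFunctor _ (1 : ℤ)).map (𝟙 _) = 𝟙 _ ≫ α
        rw [CategoryTheory.Functor.map_id, Category.comp_id, Category.id_comp]
    have w : i ≫ p = 0 := (singleFunctor A 0).map_injective (by
      rw [Functor.map_comp, Functor.map_zero]
      exact comp_distTriang_mor_zero₁₂ _ hT')
    obtain ⟨σ⟩ := h M i p w (shortExact_of_distTriang i p w α hT')
    have h0 : (singleFunctor A 0).map p ≫ α = 0 := comp_distTriang_mor_zero₂₃ _ hT'
    have h1 : σ.s ≫ p = 𝟙 X := σ.s_g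
    calc α = (singleFunctor A 0).map (σ.s ≫ p) ≫ α := by
          rw [h1, CategoryTheory.Functor.map_id, Category.id_comp]
      _ = 0 := by rw [Functor.map_comp, Category.assoc, h0, comp_zero]
  · intro h M i p w hS
    -- The connecting morphism of the extension is zero by hypothesis, so the identity of `X` lifts
    -- to the middle term.
    obtain ⟨s, hs⟩ := Triangle.coyoneda_exact₃ _ hS.singleTriangle_distinguished
      (𝟙 ((singleFunctor A 0).obj X)) (h _)
    obtain ⟨s, rfl⟩ := (singleFunctor A 0).map_surjective s
    refine ⟨ShortComplex.Splitting.ofExactOfSection _ hS.exact s ?_ hS.mono_f⟩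
    apply (singleFunctor A 0).map_injective
    rw [Functor.map_comp, CategoryTheory.Functor.map_id]
    exact hs.symm

lemma bounded_single (X : A) : (TStructure.t (C := A)).bounded ((singleFunctor A 0).obj X) :=
  ⟨⟨0, (inferInstance : ((singleFunctor A 0).obj X).IsGE 0)⟩,
    ⟨0, (inferInstance : ((singleFunctor A 0).obj X).IsLE 0)⟩⟩

/-- The object `X` of `A`, seen in the bounded derived category. -/
noncomputable def boundedSingle (X : A) : (TStructure.t (C := A)).bounded.FullSubcategory :=
  ⟨_, bounded_single X⟩

/-- The inclusion of the bounded derived category is fully faithful and commutes with the shift. -/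
lemma extOneVanishes_iff_bounded (X Y : A) :
    ExtOneVanishes (fun S : ShortComplex A => S.ShortExact) X Y ↔
      Subsingleton (boundedSingle X ⟶ (boundedSingle Y)⟦(1 : ℤ)⟧) := by
  rw [extOneVanishes_iff_derived]
  let P := (TStructure.t (C := A)).bounded
  let e : (boundedSingle X ⟶ (boundedSingle Y)⟦(1 : ℤ)⟧) ≃
      ((singleFunctor A 0).obj X ⟶ ((singleFunctor A 0).obj Y)⟦(1 : ℤ)⟧) :=
    P.fullyFaithfulι.homEquiv.trans
      ((Iso.refl _).homCongr ((P.ι.commShiftIso (1 : ℤ)).app (boundedSingle Y)))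
  rw [e.subsingleton_congr]
  exact ⟨fun h => ⟨fun a b => (h a).trans (h b).symm⟩, fun h α => Subsingleton.elim _ _⟩

/-- Serre duality identifies `Hom(X, Y⟦1⟧)` with the dual of `Hom(Y⟦1⟧, X⟦2⟧)`, and the latter Hom
group is a shift of `Hom(Y, X⟦1⟧)`. -/
theorem extOneSymmetric_of_derivedIsTwoCalabiYau {k : Type w} [Field k] [Linear k A]
    (h : DerivedIsTwoCalabiYau k A) (P : ObjectProperty A) [P.IsClosedUnderExtensions] :
    ExtOneSymmetric (confl P) := by
  refine extOneSymmetric_confl P fun Y X => ?_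
  rw [extOneVanishes_iff_bounded, extOneVanishes_iff_bounded]
  intro hYX
  obtain ⟨_, e, _⟩ := h
  let D := (TStructure.t (C := A)).bounded.FullSubcategory
  have h₁ : Subsingleton ((boundedSingle Y)⟦(1 : ℤ)⟧ ⟶ (boundedSingle X)⟦(1 : ℤ)⟧⟦(1 : ℤ)⟧) :=
    ((Functor.FullyFaithful.ofFullyFaithful (shiftFunctor D (1 : ℤ))).homEquiv
      (X := boundedSingle Y) (Y := (boundedSingle X)⟦(1 : ℤ)⟧)).symm.subsingleton
  have h₂ : Subsingleton ((boundedSingle Y)⟦(1 : ℤ)⟧ ⟶ (boundedSingle X)⟦(2 : ℤ)⟧) :=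
    ((Iso.refl _).homCongr ((shiftFunctorAdd' D (1 : ℤ) (1 : ℤ) (2 : ℤ) (by lia)).app
      (boundedSingle X))).subsingleton_congr.2 h₁
  exact (e (boundedSingle X) ((boundedSingle Y)⟦(1 : ℤ)⟧)).toEquiv.subsingleton

end Derived

/-! ### The case of a 2-Calabi-Yau stable category -/

section Stable

variable {A : Type u} [Category.{v} A] [Abelian A]

/-- Extensions of `X` by `Y` are pullbacks of `Y ⟶ I ⟶ Σ Y` along morphisms `α : X ⟶ Σ Y`. They
split precisely when `α` lifts to `I`, which in a Frobenius category means that `α` is stably zero.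
-/
lemma extOneVanishes_iff_isZero_stable [EnoughInjectives A] [EnoughProjectives A]
    (hA : ∀ X : A, Projective X ↔ Injective X) (X Y : A) :
    ExtOneVanishes (fun S : ShortComplex A => S.ShortExact) X Y ↔
      ∀ α : X ⟶ cosyz Y, stableRel A α 0 := by
  have hc : (ShortComplex.mk (Injective.ι Y) (cokernel.π (Injective.ι Y))
      (cokernel.condition _)).ShortExact := ShortComplex.ShortExact.mk'
    (ShortComplex.exact_cokernel _) (inferInstanceAs (Mono (Injective.ι Y)))
    (inferInstanceAs (Epi (cokernel.π _)))
  constructor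
  · intro h α
    have sq := IsPullback.of_hasPullback (cokernel.π (Injective.ι Y)) α
    let i : Y ⟶ pullback (cokernel.π (Injective.ι Y)) α :=
      pullback.lift (Injective.ι Y) 0 (by simp)
    have hi₁ : i ≫ pullback.fst _ _ = Injective.ι Y := pullback.lift_fst _ _ _
    have hi₂ : i ≫ pullback.snd _ _ = 0 := pullback.lift_snd _ _ _
    have : Mono i := mono_of_mono_fac hi₁
    have hl : ∀ {W : A} (t : W ⟶ pullback (cokernel.π (Injective.ι Y)) α),
        t ≫ pullback.snd _ _ = 0 → ∃ s, s ≫ i = t := fun t ht => by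
      have h0 : (t ≫ pullback.fst _ _) ≫ cokernel.π (Injective.ι Y) = 0 := by
        rw [Category.assoc, pullback.condition, reassoc_of% ht, zero_comp]
      have h1 : hc.exact.lift _ h0 ≫ Injective.ι Y = t ≫ pullback.fst _ _ := hc.exact.lift_f _ _
      refine ⟨hc.exact.lift _ h0, pullback.hom_ext ?_ ?_⟩
      · rw [Category.assoc]
        exact (congrArg _ hi₁).trans h1
      · rw [Category.assoc]
        exact (congrArg _ hi₂).trans (comp_zero.trans ht.symm)
    have hS : (ShortComplex.mk i (pullback.snd _ _) hi₂).ShortExact :=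
      ShortComplex.ShortExact.mk' (ShortComplex.exact_of_f_is_kernel _
        (KernelFork.IsLimit.ofι' _ _ fun t ht => ⟨(hl t ht).choose, (hl t ht).choose_spec⟩))
        this (inferInstanceAs (Epi (pullback.snd _ _)))
    obtain ⟨σ⟩ := h _ i _ hi₂ hS
    have hs : σ.s ≫ pullback.snd _ _ = 𝟙 X := σ.s_g
    refine ⟨Injective.under Y, σ.s ≫ pullback.fst _ _, cokernel.π _, inferInstance, ?_⟩
    rw [sub_zero, Category.assoc, pullback.condition, reassoc_of% hs]
  · intro h M i p w hS
    have := hS.mono_f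
    have := hS.epi_g
    have : Mono i := hS.mono_f
    let j : M ⟶ Injective.under Y := Injective.factorThru (Injective.ι Y) i
    have hj : i ≫ j = Injective.ι Y := Injective.comp_factorThru _ _
    let α : X ⟶ cosyz Y := hS.exact.desc (j ≫ cokernel.π _)
      (by change i ≫ _ = 0; rw [reassoc_of% hj, cokernel.condition])
    have hα : p ≫ α = j ≫ cokernel.π _ := hS.exact.g_desc _ _
    obtain ⟨J, a, b, hJ, hab⟩ := h α
    have := (hA J).2 hJ
    rw [sub_zero] at hab
    -- The injective object `J` is projective, so `α` lifts to the injective hull term; subtracting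
    -- this lift from `j` leaves a map into `Y`, the retraction.
    let b' : J ⟶ Injective.under Y := Projective.factorThru b (cokernel.π (Injective.ι Y))
    have hb' : b' ≫ cokernel.π (Injective.ι Y) = b := Projective.factorThru_comp _ _
    have hr : (j - p ≫ a ≫ b') ≫ cokernel.π (Injective.ι Y) = 0 := by
      rw [Preadditive.sub_comp, Category.assoc, Category.assoc, hb', ← hab, hα, sub_self]
    have hr' : hc.exact.lift _ hr ≫ Injective.ι Y = j - p ≫ a ≫ b' := hc.exact.lift_f _ _
    refine ⟨ShortComplex.Splitting.ofExactOfRetraction _ hS.exact (hc.exact.lift _ hr) ?_ hS.epi_g⟩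
    have w : i ≫ p = 0 := w
    change i ≫ _ = 𝟙 Y
    refine (cancel_mono (Injective.ι Y)).1 ?_
    rw [Category.assoc]
    refine (congrArg (i ≫ ·) hr').trans ?_
    rw [Preadditive.comp_sub, reassoc_of% w, hj, zero_comp, sub_zero, Category.id_comp]

/-- If `A` is Frobenius and no morphism `Σ Y ⟶ Σ Z` is stably nonzero, then no morphism `Y ⟶ Z`
is, and conversely. -/
lemma stable_cosyz_iff [EnoughInjectives A] (hA : ∀ X : A, Projective X ↔ Injective X) (Y Z : A) :
    (∀ β : cosyz Y ⟶ cosyz Z, stableRel A β 0) ↔ ∀ α : Y ⟶ Z, stableRel A α 0 := by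
  have hc : ∀ Y : A, (ShortComplex.mk (Injective.ι Y) (cokernel.π (Injective.ι Y))
      (cokernel.condition _)).ShortExact := fun Y => ShortComplex.ShortExact.mk'
    (ShortComplex.exact_cokernel _) (inferInstanceAs (Mono (Injective.ι Y)))
    (inferInstanceAs (Epi (cokernel.π _)))
  have hproj : ∀ J : A, Injective J → Projective J := fun J => (hA J).2
  constructor
  · intro h α
    obtain ⟨j, b, hj, hb⟩ := exists_cosyzMap α
    obtain ⟨J, x, y, hJ, e⟩ := h b
    have := hproj J hJ
    rw [sub_zero] at e
    let y' : J ⟶ Injective.under Z := Projective.factorThru y (cokernel.π (Injective.ι Z))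
    have hy' : y' ≫ cokernel.π (Injective.ι Z) = y := Projective.factorThru_comp _ _
    have hr : (j - cokernel.π _ ≫ x ≫ y') ≫ cokernel.π (Injective.ι Z) = 0 := by
      rw [Preadditive.sub_comp, Category.assoc, Category.assoc, hy', ← e, hb, sub_self]
    have hr' : (hc Z).exact.lift _ hr ≫ Injective.ι Z = j - cokernel.π _ ≫ x ≫ y' :=
      (hc Z).exact.lift_f _ _
    refine ⟨Injective.under Y, Injective.ι Y, (hc Z).exact.lift _ hr, inferInstance, ?_⟩
    rw [sub_zero, ← cancel_mono (Injective.ι Z), Category.assoc, hr', Preadditive.comp_sub, hj,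
      cokernel.condition_assoc, zero_comp, sub_zero]
  · intro h β
    have := hproj (Injective.under Y) inferInstance
    let j : Injective.under Y ⟶ Injective.under Z :=
      -- Projectivity of the injective objects lets `β` be desuspended: it is induced by some `Y ⟶
      -- Z`, which is stably zero by hypothesis.
      Projective.factorThru (cokernel.π _ ≫ β) (cokernel.π (Injective.ι Z))
    have hj : j ≫ cokernel.π (Injective.ι Z) = cokernel.π _ ≫ β := Projective.factorThru_comp _ _
    have hα₀ : (Injective.ι Y ≫ j) ≫ cokernel.π (Injective.ι Z) = 0 := by
      rw [Category.assoc, hj, cokernel.condition_assoc, zero_comp]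
    have hα : (hc Z).exact.lift _ hα₀ ≫ Injective.ι Z = Injective.ι Y ≫ j := (hc Z).exact.lift_f _ _
    exact cosyz_stable (h ((hc Z).exact.lift _ hα₀)) (j := j) (j' := 0) hα.symm (by simp) hj.symm
      (by simp)

/-- Duality pairs `Hom(X, Σ Y)` with `Hom(Σ Y, Σ² X)`, and the vanishing of the latter amounts to
that of `Hom(Y, Σ X)` by `stable_cosyz_iff`. -/
theorem extOneSymmetric_of_stableIsTwoCalabiYau [EnoughInjectives A] {k : Type w} [Field k]
    [Linear k A] (h : StableIsTwoCalabiYau A k) (P : ObjectProperty A)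
    [P.IsClosedUnderExtensions] : ExtOneSymmetric (confl P) := by
  obtain ⟨hP, hA, _, e, _⟩ := h
  refine extOneSymmetric_confl P fun Y X => ?_
  rw [extOneVanishes_iff_isZero_stable hA, extOneVanishes_iff_isZero_stable hA]
  intro hYX
  let F := CategoryTheory.Quotient.functor (stableRel A)
  have h₁ : Subsingleton (F.obj (cosyz Y) ⟶ F.obj (cosyz (cosyz X))) :=
    ⟨fun a b => by
      obtain ⟨a, rfl⟩ := F.map_surjective a
      obtain ⟨b, rfl⟩ := F.map_surjective b
      have := (stable_cosyz_iff hA Y (cosyz X)).2 hYX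
      exact (CategoryTheory.Quotient.sound _ (this a)).trans
        (CategoryTheory.Quotient.sound _ (this b)).symm⟩
  have h₂ : Subsingleton (F.obj X ⟶ F.obj (cosyz Y)) := by
    have : Subsingleton (F.obj (cosyz Y) ⟶ (suspension A ⋙ suspension A).obj (F.obj X)) := h₁
    exact (e (F.obj X) (F.obj (cosyz Y))).toEquiv.subsingleton
  intro α
  exact (CategoryTheory.Quotient.functor_map_eq_iff (stableRel A) α 0).1 (Subsingleton.elim _ _)

end Stable

end TorsionFrob

namespace TorsionFrob

open Abelian

/-! ### Injective dimension tested on finitely generated modules -/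

section Baer

variable {R : Type v} [Ring R]

/-- Baer's criterion for the injective dimension. -/
theorem hasInjectiveDimensionLE_of_finite (n : ℕ) (M : ModuleCat.{v} R)
    (h : ∀ N : ModuleCat.{v} R, Module.Finite R N → Subsingleton (Ext N M (n + 1))) :
    HasInjectiveDimensionLE M n := by
  induction n generalizing M with
  | zero =>
    rw [HasInjectiveDimensionLE, zero_add, ← injective_iff_hasInjectiveDimensionLT_one,
      ← Module.injective_iff_injective_object R M, ← Module.Baer.iff_injective]
    intro I g
    -- The obstruction to extending `g` from `I` to `R` lies in `Ext¹(R ⧸ I, M)`, and `R ⧸ I` is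
    -- cyclic.
    let S : ShortComplex (ModuleCat.{v} R) :=
      ShortComplex.mk (ModuleCat.ofHom I.subtype) (ModuleCat.ofHom I.mkQ) (by
        ext x; exact (Submodule.Quotient.mk_eq_zero I).2 x.2)
    have hS : S.ShortExact := ModuleCat.shortComplex_shortExact S
      (fun x => by
        change I.mkQ x = 0 ↔ x ∈ Set.range I.subtype
        simp)
      Subtype.val_injective I.mkQ_surjective
    have hfin : Module.Finite R S.X₃ := inferInstanceAs (Module.Finite R (R ⧸ I))
    have := h S.X₃ hfin
    obtain ⟨x, hx⟩ := Ext.contravariant_sequence_exact₁ hS M (Ext.mk₀ (ModuleCat.ofHom g))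
      (n₁ := 1) rfl (Subsingleton.elim _ _)
    obtain ⟨x, rfl⟩ := Ext.mk₀_bijective _ _ |>.2 x
    rw [Ext.mk₀_comp_mk₀] at hx
    have hx := (Ext.mk₀_bijective _ _).1 hx
    exact ⟨x.hom, fun y hy => ConcreteCategory.congr_hom hx ⟨y, hy⟩⟩
  | succ n ih =>
    -- Passing to the cokernel of an embedding into an injective module lowers both the dimension
    -- and the degree of `Ext` by one.
    let ⟨I, _, f, _⟩ := EnoughInjectives.presentation M
    let S : ShortComplex (ModuleCat.{v} R) := ShortComplex.mk f (cokernel.π f) (cokernel.condition f)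
    have hS : S.ShortExact := ShortComplex.ShortExact.mk' (ShortComplex.exact_cokernel f) ‹_›
      (inferInstanceAs (Epi (cokernel.π f)))
    refine (hS.hasInjectiveDimensionLT_X₃_iff n ‹_›).1 (ih S.X₃ fun N hN => ⟨fun x y => ?_⟩)
    have := h N hN
    have key : ∀ x : Ext N S.X₃ (n + 1), x = 0 := fun x => by
      obtain ⟨y, rfl⟩ := Ext.covariant_sequence_exact₃ N hS x (n₁ := n + 1 + 1) rfl
        (Subsingleton.elim _ _)
      have : Injective S.X₂ := ‹Injective I›
      rw [y.eq_zero_of_injective, Ext.zero_comp]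
    rw [key x, key y]

end Baer

/-! ### Direct summands of finite powers of an object -/

section Summand

variable {D : Type u} [Category.{v} D] [Preadditive D]

/-- `X` is a direct summand of a finite direct sum of copies of `Q`, without reference to such a
direct sum. -/
def IsSummand (Q X : D) : Prop :=
  ∃ (n : ℕ) (a : Fin n → (X ⟶ Q)) (b : Fin n → (Q ⟶ X)), ∑ i, a i ≫ b i = 𝟙 X

lemma isSummand_self (Q : D) : IsSummand Q Q := ⟨1, fun _ => 𝟙 Q, fun _ => 𝟙 Q, by simp⟩

lemma IsSummand.map {D' : Type w} [Category.{w'} D'] [Preadditive D'] (F : D ⥤ D') [F.Additive]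
    {Q X : D} (h : IsSummand Q X) : IsSummand (F.obj Q) (F.obj X) := by
  obtain ⟨n, a, b, e⟩ := h
  refine ⟨n, fun i => F.map (a i), fun i => F.map (b i), ?_⟩
  rw [← CategoryTheory.Functor.map_id, ← e, Functor.map_sum]
  simp

lemma IsSummand.projective {Q X : D} (h : IsSummand Q X) [Projective Q] : Projective X where
  factors f e _ := by
    obtain ⟨n, a, b, hab⟩ := h
    refine ⟨∑ i, a i ≫ Projective.factorThru (b i ≫ f) e, ?_⟩
    simp_rw [Preadditive.sum_comp, Category.assoc, Projective.factorThru_comp]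
    simp_rw [← Category.assoc, ← Preadditive.sum_comp, hab, Category.id_comp]

lemma IsSummand.isProj {c : ObjectProperty (ShortComplex D)} {Q X : D} (h : IsSummand Q X)
    (hQ : IsProj c Q) : IsProj c X := by
  intro S hS f
  obtain ⟨n, a, b, hab⟩ := h
  choose g hg using fun i => hQ S hS (b i ≫ f)
  refine ⟨∑ i, a i ≫ g i, ?_⟩
  simp_rw [Preadditive.sum_comp, Category.assoc, hg]
  simp_rw [← Category.assoc, ← Preadditive.sum_comp, hab, Category.id_comp]

lemma IsSummand.isInj {c : ObjectProperty (ShortComplex D)} {Q X : D} (h : IsSummand Q X)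
    (hQ : IsInj c Q) : IsInj c X := by
  intro S hS f
  obtain ⟨n, a, b, hab⟩ := h
  choose g hg using fun i => hQ S hS (f ≫ a i)
  refine ⟨∑ i, g i ≫ b i, ?_⟩
  simp_rw [Preadditive.comp_sum, ← Category.assoc, hg]
  simp_rw [Category.assoc, ← Preadditive.comp_sum, hab, Category.comp_id]

lemma IsSummand.op {Q X : D} (h : IsSummand Q X) : IsSummand (Opposite.op Q) (Opposite.op X) := by
  obtain ⟨n, a, b, e⟩ := h
  refine ⟨n, fun i => (b i).op, fun i => (a i).op, ?_⟩
  rw [← op_id, ← e, op_sum]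
  simp

lemma isSummand_of_bicone {Q X : D} {n : ℕ} {B : Bicone (fun _ : Fin n => Q)} (hB : B.IsBilimit)
    (r : Retract X B.pt) : IsSummand Q X := by
  refine ⟨n, fun i => r.i ≫ B.π i, fun i => B.ι i ≫ r.r, ?_⟩
  have h : ∑ i, B.π i ≫ B.ι i = 𝟙 B.pt := IsBilimit.total hB
  simp_rw [Category.assoc, ← Preadditive.comp_sum, ← Category.assoc (B.π _), ← Preadditive.sum_comp,
    h, Category.id_comp, r.retract]

lemma IsSummand.of_retract {Q X Y : D}
    (h : IsSummand Q Y) (r : Retract X Y) : IsSummand Q X := by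
  obtain ⟨n, a, b, e⟩ := h
  refine ⟨n, fun i => r.i ≫ a i, fun i => b i ≫ r.r, ?_⟩
  simp_rw [Category.assoc, ← Preadditive.comp_sum, ← Category.assoc (a _), ← Preadditive.sum_comp,
    e, Category.id_comp, r.retract]

lemma IsSummand.of_addClosure {Q X : D}
    (h : addClosure Q X) : IsSummand Q X := by
  obtain ⟨n, B, ⟨hB⟩, ⟨r⟩⟩ := h
  exact isSummand_of_bicone hB r

/-- The families `a` and `b` assemble into a retract of the biproduct. The version with sums is
transported by additive functors and to the opposite category without choosing biproducts. -/
lemma addClosure_iff_isSummand [HasFiniteBiproducts D] (Q X : D) :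
    addClosure Q X ↔ IsSummand Q X := by
  refine ⟨IsSummand.of_addClosure, ?_⟩
  rintro ⟨n, a, b, e⟩
  exact ⟨n, _, ⟨biproduct.isBilimit _⟩, ⟨biproduct.lift a, biproduct.desc b,
    biproduct.lift_desc.trans e⟩⟩

lemma addClosure_self (Q : D) : addClosure Q Q := by
  let B : Bicone (fun _ : Fin 1 => Q) :=
    { pt := Q
      π := fun _ => 𝟙 Q
      ι := fun _ => 𝟙 Q
      ι_π := fun i j => by simp [Subsingleton.elim i j] }
  exact ⟨1, B, ⟨isBilimitOfTotal B (by simp [B])⟩, ⟨Retract.refl _⟩⟩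

end Summand

/-! ### Projective-injective generators: full faithfulness and vanishing of `Ext` -/

section Generator

variable {D : Type u} [Category.{v} D] [Preadditive D] {R : Type v} [Ring R]

/-- `F` is a functor like `Hom(Q, -)` with values in modules over the endomorphism ring of `Q`,
where `Q` is projective and injective in the exact category `(D, c)`, and each object is a deflation
quotient of an object of `add Q`. -/
structure IsProjInjGenerator (c : ObjectProperty (ShortComplex D)) (F : D ⥤ ModuleCat.{v} R)
    [F.Additive] (Q : D) : Prop where
  free : Nonempty (F.obj Q ≅ ModuleCat.of R R)
  bijective : ∀ X, Function.Bijective (fun f : Q ⟶ X => F.map f)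
  isColimit : ∀ S, c S → Nonempty (IsColimit (CokernelCofork.ofπ S.g S.zero))
  shortExact : ∀ S, c S → (S.map F).ShortExact
  exact_kernel : ∀ {K X Y : D} (k : K ⟶ X) (a : X ⟶ Y) (w : k ≫ a = 0),
    Nonempty (IsLimit (KernelFork.ofι k w)) →
      Mono (F.map k) ∧ ((ShortComplex.mk k a w).map F).Exact
  isInj : IsInj c Q
  cover : ∀ X, ∃ (Q₀ : D) (p : Q₀ ⟶ X), IsSummand Q Q₀ ∧ IsDeflation c p

namespace IsProjInjGenerator

variable {c : ObjectProperty (ShortComplex D)} {F : D ⥤ ModuleCat.{v} R} [F.Additive] {Q : D}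
  (h : IsProjInjGenerator c F Q)

include h

lemma projective_obj : Projective (F.obj Q) := by
  obtain ⟨e⟩ := h.free
  have : Projective (ModuleCat.of R R) := (IsProjective.iff_projective R).1 inferInstance
  exact Projective.of_iso e.symm this

lemma projective_of_isSummand {X : D} (hX : IsSummand Q X) : Projective (F.obj X) :=
  have := h.projective_obj
  (hX.map F).projective

/-- A morphism `f` out of `X` is recovered from the composites `b i ≫ f` as the sum of the `a i ≫ b
i ≫ f`, which reduces the claim to morphisms out of `Q`. -/
lemma bijective_of_isSummand {X : D} (hX : IsSummand Q X) (Y : D) :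
    Function.Bijective (fun f : X ⟶ Y => F.map f) := by
  have hX' := hX
  obtain ⟨n, a, b, e⟩ := hX
  constructor
  · intro f g hfg
    have hb : ∀ i, b i ≫ f = b i ≫ g := fun i => (h.bijective Y).1 (by
      change F.map _ = F.map _
      have hfg : F.map f = F.map g := hfg
      rw [F.map_comp, F.map_comp, hfg])
    rw [← Category.id_comp f, ← Category.id_comp g, ← e, Preadditive.sum_comp,
      Preadditive.sum_comp]
    simp_rw [Category.assoc, hb]
  · intro φ
    choose g hg using fun i => (h.bijective Y).2 (F.map (b i) ≫ φ)
    have hg : ∀ i, F.map (g i) = F.map (b i) ≫ φ := hg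
    refine ⟨∑ i, a i ≫ g i, ?_⟩
    change F.map _ = φ
    rw [Functor.map_sum]
    simp_rw [F.map_comp, hg, ← Category.assoc, ← F.map_comp, ← Preadditive.sum_comp,
      ← Functor.map_sum, e]
    simp

lemma faithful : F.Faithful where
  map_injective {X Y f g} hfg := by
    obtain ⟨Q₀, p, hQ₀, K, i, w, hc⟩ := h.cover X
    obtain ⟨hl⟩ := h.isColimit _ hc
    have : Epi p := epi_of_isColimit_cofork hl
    rw [← cancel_epi p]
    apply (h.bijective_of_isSummand hQ₀ Y).1
    change F.map _ = F.map _
    rw [F.map_comp, F.map_comp, hfg]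

/-- Precomposed with a cover `p` by a summand, `φ` comes from a morphism `g`. By faithfulness `g`
kills the kernel of `p`, so it descends along the cokernel `p`. -/
lemma full : F.Full where
  map_surjective {X Y} φ := by
    have := h.faithful
    obtain ⟨Q₀, p, hQ₀, K, i, w, hc⟩ := h.cover X
    obtain ⟨hl⟩ := h.isColimit _ hc
    have hF := h.shortExact _ hc
    have : Epi (F.map p) := hF.epi_g
    obtain ⟨g, hg⟩ := (h.bijective_of_isSummand hQ₀ Y).2 (F.map p ≫ φ)
    have hg : F.map g = F.map p ≫ φ := hg
    have hw : i ≫ g = 0 := F.map_injective (by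
      rw [F.map_comp, hg, ← Category.assoc, ← F.map_comp, w, F.map_zero, F.map_zero, zero_comp])
    obtain ⟨d, hd⟩ := CokernelCofork.IsColimit.desc' hl g hw
    have hd : p ≫ d = g := hd
    refine ⟨d, ?_⟩
    rw [← cancel_epi (F.map p), ← hg, ← hd, F.map_comp]

lemma finite (X : D) : Module.Finite R (F.obj X) := by
  obtain ⟨e⟩ := h.free
  obtain ⟨Q₀, p, ⟨n, a, b, hab⟩, K, i, w, hc⟩ := h.cover X
  have : Epi (F.map p) := (h.shortExact _ hc).epi_g
  have hs : Function.Surjective (F.map p) := (ModuleCat.epi_iff_surjective _).1 this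
  have hfin : Module.Finite R (F.obj Q) :=
    Module.Finite.equiv e.symm.toLinearEquiv
  let L : (Fin n → F.obj Q) →ₗ[R] F.obj Q₀ := ∑ i, (F.map (b i)).hom ∘ₗ LinearMap.proj i
  have hL : Function.Surjective L := fun x => ⟨fun i => F.map (a i) x, by
    have h1 : ∑ i, F.map (a i) ≫ F.map (b i) = 𝟙 _ := by
      simp_rw [← F.map_comp, ← Functor.map_sum, hab, F.map_id]
    have h2 := congrArg (fun f => f.hom x) h1
    simpa [L, ModuleCat.hom_sum] using h2⟩
  have : Module.Finite R (F.obj Q₀) := Module.Finite.of_surjective L hL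
  exact Module.Finite.of_surjective (F.map p).hom hs

/-- Shifting along a cover `K ⟶ Q₀ ⟶ X` reduces to degree one. There a class is the connecting image
of some `F g` with `g : K ⟶ Q`, and injectivity of `Q` extends `g` over `Q₀`, which kills the class.
-/
lemma subsingleton_ext_obj (X : D) (i : ℕ) (hi : 0 < i) :
    Subsingleton (Ext (F.obj X) (F.obj Q) i) := by
  have := h.full
  suffices key : ∀ (i : ℕ) (X : D) (x : Ext (F.obj X) (F.obj Q) (i + 1)), x = 0 by
    obtain ⟨j, rfl⟩ := Nat.exists_eq_succ_of_ne_zero hi.ne'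
    exact ⟨fun x y => (key j X x).trans (key j X y).symm⟩
  intro i
  induction i with
  | zero =>
    intro X x
    obtain ⟨Q₀, p, hQ₀, K, f, w, hc⟩ := h.cover X
    have hF := h.shortExact _ hc
    have : Projective (F.obj Q₀) := h.projective_of_isSummand hQ₀
    obtain ⟨y, rfl⟩ := Ext.contravariant_sequence_exact₃ hF _ x (n₀ := 0)
      (Ext.eq_zero_of_projective (P := F.obj Q₀) _) rfl
    obtain ⟨φ, rfl⟩ := (Ext.mk₀_bijective _ _).2 y
    obtain ⟨g, rfl⟩ := F.map_surjective φ
    obtain ⟨t, rfl⟩ := h.isInj _ hc g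
    have e : F.map (f ≫ t) = F.map f ≫ F.map t := F.map_comp _ _
    have h0 : hF.extClass.comp ((Ext.mk₀ (F.map f)).comp (Ext.mk₀ (F.map t)) (zero_add 0))
      (add_zero 1) = 0 := hF.extClass_comp_assoc _
    rw [Ext.mk₀_comp_mk₀, ← e] at h0
    exact h0
  | succ i ih =>
    intro X x
    obtain ⟨Q₀, p, hQ₀, K, f, w, hc⟩ := h.cover X
    have hF := h.shortExact _ hc
    have : Projective (F.obj Q₀) := h.projective_of_isSummand hQ₀
    obtain ⟨y, rfl⟩ := Ext.contravariant_sequence_exact₃ hF _ x (n₀ := i + 1)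
      (Ext.eq_zero_of_projective (P := F.obj Q₀) _) (by omega)
    exact (congrArg (fun z => hF.extClass.comp z _) (ih K y)).trans (Ext.comp_zero _ _ _ _ _)

end IsProjInjGenerator

end Generator

end TorsionFrob

namespace TorsionFrob

open Abelian

/-! ### Dimension shifting for modules -/

section DimensionShift

variable {R : Type v} [Ring R] {S : ShortComplex (ModuleCat.{v} R)} (hS : S.ShortExact)
  (Y : ModuleCat.{v} R)

include hS

lemma subsingleton_ext_X₃ [Projective S.X₂] (i : ℕ) [Subsingleton (Ext S.X₁ Y (i + 1))] :
    Subsingleton (Ext S.X₃ Y (i + 2)) := by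
  suffices key : ∀ x : Ext S.X₃ Y (i + 2), x = 0 from ⟨fun x y => (key x).trans (key y).symm⟩
  intro x
  obtain ⟨y, rfl⟩ := Ext.contravariant_sequence_exact₃ hS _ x (n₀ := i + 1)
    (Ext.eq_zero_of_projective (P := S.X₂) _) (by omega)
  rw [Subsingleton.elim y 0, Ext.comp_zero]

lemma subsingleton_ext_X₁ [Projective S.X₂] (i : ℕ) [Subsingleton (Ext S.X₃ Y (i + 2))] :
    Subsingleton (Ext S.X₁ Y (i + 1)) := by
  suffices key : ∀ x : Ext S.X₁ Y (i + 1), x = 0 from ⟨fun x y => (key x).trans (key y).symm⟩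
  intro x
  obtain ⟨y, rfl⟩ := Ext.contravariant_sequence_exact₁ hS _ x (n₁ := i + 2) (by omega)
    (Subsingleton.elim _ _)
  rw [y.eq_zero_of_projective, Ext.comp_zero]

/-- The obstruction to extending `φ` is its connecting image in `Ext¹(S.X₃, Y)`. -/
lemma exists_extension [Subsingleton (Ext S.X₃ Y 1)] (φ : S.X₁ ⟶ Y) :
    ∃ ψ : S.X₂ ⟶ Y, S.f ≫ ψ = φ := by
  obtain ⟨x, hx⟩ := Ext.contravariant_sequence_exact₁ hS Y (Ext.mk₀ φ) (n₁ := 1) rfl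
    (Subsingleton.elim _ _)
  obtain ⟨x, rfl⟩ := (Ext.mk₀_bijective _ _).2 x
  rw [Ext.mk₀_comp_mk₀] at hx
  exact ⟨x, (Ext.mk₀_bijective _ _).1 hx⟩

omit hS in
lemma subsingleton_ext_of_iso {M Y Y' : ModuleCat.{v} R} (e : Y ≅ Y') (i : ℕ)
    [Subsingleton (Ext M Y i)] : Subsingleton (Ext M Y' i) := by
  suffices key : ∀ x : Ext M Y' i, x = 0 from ⟨fun x y => (key x).trans (key y).symm⟩
  intro x
  have h : (x.comp (Ext.mk₀ e.inv) (add_zero i)).comp (Ext.mk₀ e.hom) (add_zero i) = x := by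
    rw [Ext.comp_assoc_of_third_deg_zero, Ext.mk₀_comp_mk₀, e.inv_hom_id, Ext.comp_mk₀_id]
  rw [← h, Subsingleton.elim (x.comp (Ext.mk₀ e.inv) (add_zero i)) 0, Ext.zero_comp]

end DimensionShift

/-! ### Resolutions by the generator and Gorenstein projective modules -/

section Generator

variable {D : Type u} [Category.{v} D] [Preadditive D] {R : Type v} [Ring R]

/-- Morphisms to `Q` that extend along `g` extend to morphisms to summands of powers of `Q`. -/
lemma IsSummand.exists_extension {Q J N Y : D} (hJ : IsSummand Q J) (g : N ⟶ Y)
    (hg : ∀ φ : N ⟶ Q, ∃ ψ : Y ⟶ Q, g ≫ ψ = φ) (j : N ⟶ J) : ∃ t : Y ⟶ J, g ≫ t = j := by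
  obtain ⟨n, a, b, e⟩ := hJ
  choose s hs using fun i => hg (j ≫ a i)
  refine ⟨∑ i, s i ≫ b i, ?_⟩
  simp_rw [Preadditive.comp_sum, ← Category.assoc, hs]
  simp_rw [Category.assoc, ← Preadditive.comp_sum, e, Category.comp_id]

lemma isSummand_biproduct [HasFiniteBiproducts D] (Q : D) (n : ℕ) :
    IsSummand Q (⨁ fun _ : Fin n => Q) :=
  isSummand_of_bicone (biproduct.isBilimit _) (Retract.refl _)

namespace IsProjInjGenerator

variable {c : ObjectProperty (ShortComplex D)} {F : D ⥤ ModuleCat.{v} R} [F.Additive] {Q : D}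
  (h : IsProjInjGenerator c F Q)

include h

/-- Under `F Q ≅ R`, the object `F (Qⁿ)` is free of rank `n`; its basis is sent to a finite
generating family of `M`. -/
lemma exists_epi_of_finite [HasFiniteBiproducts D] (M : ModuleCat.{v} R) [Module.Finite R M] :
    ∃ (Q₀ : D) (p : F.obj Q₀ ⟶ M), IsSummand Q Q₀ ∧ Epi p := by
  obtain ⟨e⟩ := h.free
  obtain ⟨n, s, hs⟩ := Module.Finite.exists_fin (R := R) (M := M)
  let q (i : Fin n) : F.obj Q ⟶ M := e.hom ≫ ModuleCat.ofHom (LinearMap.toSpanSingleton R M (s i))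
  refine ⟨⨁ fun _ : Fin n => Q, ∑ i, F.map (biproduct.π _ i) ≫ q i, isSummand_biproduct Q n, ?_⟩
  have hq : ∀ i, F.map (biproduct.ι (fun _ : Fin n => Q) i) ≫
      ∑ i, F.map (biproduct.π _ i) ≫ q i = q i := by
    intro i
    rw [Preadditive.comp_sum, Finset.sum_eq_single i]
    · rw [← Category.assoc, ← F.map_comp, biproduct.ι_π_self, F.map_id, Category.id_comp]
    · intro j _ hj
      rw [← Category.assoc, ← F.map_comp, biproduct.ι_π_ne _ hj.symm, F.map_zero, zero_comp]
    · simp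
  rw [ModuleCat.epi_iff_range_eq_top, eq_top_iff, ← hs, Submodule.span_le]
  rintro _ ⟨i, rfl⟩
  refine ⟨F.map (biproduct.ι (fun _ : Fin n => Q) i) (e.inv (1 : R)), ?_⟩
  have h1 := congrArg (fun f => f.hom (e.inv (1 : R))) (hq i)
  refine h1.trans ?_
  have h2 : e.hom (e.inv (1 : R)) = (1 : R) := congrArg (fun f => f.hom (1 : R)) e.inv_hom_id
  change (e.hom (e.inv (1 : R)) : R) • s i = s i
  rw [h2, one_smul]

/-- Each finitely generated module is the cokernel of a map between objects of `add Q`. -/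
lemma exists_resolution [HasFiniteBiproducts D] [HasKernels D] [IsNoetherianRing R]
    (M : ModuleCat.{v} R) [Module.Finite R M] :
    ∃ (K Q₁ Q₀ : D) (k : K ⟶ Q₁) (a : Q₁ ⟶ Q₀) (N : ModuleCat.{v} R) (p₁ : F.obj Q₁ ⟶ N)
      (i : N ⟶ F.obj Q₀) (p₀ : F.obj Q₀ ⟶ M) (w₁ : F.map k ≫ p₁ = 0) (w₀ : i ≫ p₀ = 0),
      IsSummand Q Q₁ ∧ IsSummand Q Q₀ ∧ (ShortComplex.mk _ _ w₁).ShortExact ∧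
        (ShortComplex.mk _ _ w₀).ShortExact ∧ p₁ ≫ i = F.map a := by
  obtain ⟨Q₀, p₀, hQ₀, _⟩ := h.exists_epi_of_finite M
  have := h.finite Q₀
  let N := ModuleCat.of R (LinearMap.ker p₀.hom)
  let i : N ⟶ F.obj Q₀ := ModuleCat.ofHom (LinearMap.ker p₀.hom).subtype
  have w₀ : i ≫ p₀ = 0 := by
    ext x
    exact x.2
  have h₀ : (ShortComplex.mk _ _ w₀).ShortExact := ModuleCat.shortComplex_shortExact _
    (fun x => by
      change p₀.hom x = 0 ↔ x ∈ Set.range (LinearMap.ker p₀.hom).subtype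
      simp)
    Subtype.val_injective ((ModuleCat.epi_iff_surjective _).1 ‹_›)
  -- This is where the noetherian hypothesis enters: the first syzygy is again finitely generated
  -- and can be covered.
  have : Module.Finite R N := inferInstanceAs (Module.Finite R (LinearMap.ker p₀.hom))
  obtain ⟨Q₁, p₁, hQ₁, _⟩ := h.exists_epi_of_finite N
  obtain ⟨a, ha⟩ := (h.bijective_of_isSummand hQ₁ Q₀).2 (p₁ ≫ i)
  have ha : F.map a = p₁ ≫ i := ha
  obtain ⟨_, hk⟩ := h.exact_kernel (kernel.ι a) a (kernel.condition a) ⟨kernelIsKernel a⟩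
  have : Mono i := h₀.mono_f
  have w₁ : F.map (kernel.ι a) ≫ p₁ = 0 := by
    rw [← cancel_mono i, Category.assoc, ← ha, ← F.map_comp, kernel.condition, F.map_zero,
      zero_comp]
  refine ⟨kernel a, Q₁, Q₀, kernel.ι a, a, N, p₁, i, p₀, w₁, w₀, hQ₁, hQ₀, ?_, h₀, ha.symm⟩
  refine ShortComplex.ShortExact.mk' ?_ ‹_› ‹_›
  -- Exactness at `F Q₁` is known for the composite into `F Q₀`; since `i` is mono, it holds for
  -- `p₁` as well.
  let f : ShortComplex.mk _ _ w₁ ⟶ (ShortComplex.mk _ _ (kernel.condition a)).map F :=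
    { τ₁ := 𝟙 _
      τ₂ := 𝟙 _
      τ₃ := i
      comm₁₂ := (Category.id_comp _).trans (Category.comp_id _).symm
      comm₂₃ := (Category.id_comp _).trans ha }
  have : Epi f.τ₁ := inferInstanceAs (Epi (𝟙 _))
  have : IsIso f.τ₂ := inferInstanceAs (IsIso (𝟙 _))
  have : Mono f.τ₃ := ‹Mono i›
  exact (ShortComplex.exact_iff_of_epi_of_isIso_of_mono f).2 hk

/-- The ring `R` has injective dimension at most two. -/
lemma hasInjectiveDimensionLE_two [HasFiniteBiproducts D] [HasKernels D] [IsNoetherianRing R] :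
    HasInjectiveDimensionLE (ModuleCat.of.{v} R R) 2 := by
  refine hasInjectiveDimensionLE_of_finite 2 _ fun M hM => ?_
  obtain ⟨e⟩ := h.free
  obtain ⟨K, Q₁, Q₀, k, a, N, p₁, i, p₀, w₁, w₀, hQ₁, hQ₀, h₁, h₀, -⟩ := h.exists_resolution M
  have : Projective (ShortComplex.mk _ _ w₁).X₂ := h.projective_of_isSummand hQ₁
  have : Projective (ShortComplex.mk _ _ w₀).X₂ := h.projective_of_isSummand hQ₀
  -- Two shifts carry the vanishing of `Ext¹` on `F K` to `Ext²` on the syzygy `N` and then to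
  -- `Ext³` on `M`.
  have : Subsingleton (Ext (ShortComplex.mk _ _ w₁).X₁ (F.obj Q) (0 + 1)) :=
    h.subsingleton_ext_obj K 1 one_pos
  have : Subsingleton (Ext (ShortComplex.mk _ _ w₀).X₁ (F.obj Q) (1 + 1)) :=
    subsingleton_ext_X₃ h₁ (F.obj Q) 0
  have : Subsingleton (Ext M (F.obj Q) (2 + 1)) := subsingleton_ext_X₃ h₀ (F.obj Q) 1
  exact subsingleton_ext_of_iso e _

lemma gp_obj (X : D) : GP R (F.obj X) := by
  obtain ⟨e⟩ := h.free
  refine ⟨h.finite X, fun i hi => ?_⟩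
  have := h.subsingleton_ext_obj X i hi
  exact subsingleton_ext_of_iso e i

lemma exists_extension {S : ShortComplex D} (hS : (S.map F).ShortExact) (φ : S.X₁ ⟶ Q) :
    ∃ ψ : S.X₂ ⟶ Q, S.f ≫ ψ = φ := by
  have := h.full
  have := h.faithful
  have : Subsingleton (Ext (S.map F).X₃ (F.obj Q) 1) := h.subsingleton_ext_obj S.X₃ 1 one_pos
  obtain ⟨ψ, hψ⟩ := TorsionFrob.exists_extension hS (F.obj Q) (F.map φ)
  obtain ⟨ψ, rfl⟩ := F.map_surjective ψ
  exact ⟨ψ, F.map_injective ((F.map_comp _ _).trans hψ)⟩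

/-- The exact sequence of a conflation identifies cokernels. -/
lemma exists_iso_of_inflation {X Y Z : D} {i : X ⟶ Y} {p : Y ⟶ Z} {w : i ≫ p = 0}
    (hc : c (ShortComplex.mk i p w)) {N : ModuleCat.{v} R} {q : F.obj Y ⟶ N}
    {w' : F.map i ≫ q = 0} (hN : (ShortComplex.mk _ _ w').ShortExact) :
    ∃ e : F.obj Z ≅ N, F.map p ≫ e.hom = q := by
  have hF := h.shortExact _ hc
  exact ⟨hF.gIsCokernel.coconePointUniqueUpToIso hN.gIsCokernel,
    hF.gIsCokernel.comp_coconePointUniqueUpToIso_hom hN.gIsCokernel WalkingParallelPair.one⟩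

variable (hcog : ∀ X, ∃ (J : D) (j : X ⟶ J), IsSummand Q J ∧ IsInflation c j)
  (hobs : ∀ {X Y Z : D} (i : X ⟶ Y) (j : Y ⟶ Z), IsInflation c (i ≫ j) → IsInflation c i)

include hcog hobs

-- Embed `N` by an inflation `j` into a summand `J` of a power of `Q`. The hypothesis factors `j`
-- through `g`, and `hobs` makes the first factor of an inflation an inflation.
omit h [F.Additive] in
lemma isInflation_of_extension {N Y : D} (g : N ⟶ Y)
    (hg : ∀ φ : N ⟶ Q, ∃ ψ : Y ⟶ Q, g ≫ ψ = φ) : IsInflation c g := by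
  obtain ⟨J, j, hJ, hj⟩ := hcog N
  obtain ⟨t, ht⟩ := hJ.exists_extension g hg j
  exact hobs g t (ht ▸ hj)

/-- `F` reflects conflations. -/
lemma conflation_of_shortExact [c.IsClosedUnderIsomorphisms] {S : ShortComplex D}
    (hS : (S.map F).ShortExact) : c S := by
  have := h.full
  have := h.faithful
  obtain ⟨Z, p, w, hc⟩ := isInflation_of_extension hcog hobs S.f (h.exists_extension hS)
  obtain ⟨e, he⟩ := h.exists_iso_of_inflation hc hS
  let e' : ShortComplex.mk S.f p w ≅ S :=
    ShortComplex.isoMk (Iso.refl _) (Iso.refl _) (F.preimageIso e)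
      ((Category.id_comp _).trans (Category.comp_id _).symm)
      ((Category.id_comp _).trans (F.map_injective (by
        rw [F.map_comp, F.preimageIso_hom, F.map_preimage]
        exact he.symm)))
  exact c.prop_of_iso e' hc

/-- Each Gorenstein projective module is in the essential image of `F`. -/
lemma exists_iso_of_gp [HasFiniteBiproducts D] [HasKernels D] [IsNoetherianRing R]
    {M : ModuleCat.{v} R} (hM : GP R M) : ∃ X, Nonempty (F.obj X ≅ M) := by
  have := h.full
  have := h.faithful
  obtain ⟨_, hM⟩ := hM
  obtain ⟨e⟩ := h.free
  have hM : ∀ i : ℕ, 0 < i → Subsingleton (Ext M (F.obj Q) i) := fun i hi => by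
    have := hM i hi
    exact subsingleton_ext_of_iso e.symm i
  obtain ⟨K, Q₁, Q₀, k, a, N, p₁, i, p₀, w₁, w₀, hQ₁, hQ₀, h₁, h₀, -⟩ := h.exists_resolution M
  have : Projective (ShortComplex.mk _ _ w₀).X₂ := h.projective_of_isSummand hQ₀
  have : Subsingleton (Ext (ShortComplex.mk _ _ w₀).X₃ (F.obj Q) 1) := hM 1 one_pos
  have : Subsingleton (Ext (ShortComplex.mk _ _ w₀).X₃ (F.obj Q) (0 + 2)) := hM 2 two_pos
  have : Subsingleton (Ext (ShortComplex.mk _ _ w₁).X₃ (F.obj Q) 1) :=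
    subsingleton_ext_X₁ h₀ (F.obj Q) 0
  -- `Ext²(M, F Q) = 0` gives `Ext¹(N, F Q) = 0`, so `k` is an inflation, and its cokernel `N'`
  -- satisfies `F N' ≅ N`.
  obtain ⟨N', p, w, hc⟩ := isInflation_of_extension hcog hobs k fun φ => by
    obtain ⟨ψ, hψ⟩ := TorsionFrob.exists_extension h₁ (F.obj Q) (F.map φ)
    obtain ⟨ψ, rfl⟩ := F.map_surjective ψ
    exact ⟨ψ, F.map_injective ((F.map_comp _ _).trans hψ)⟩
  obtain ⟨e', he'⟩ := h.exists_iso_of_inflation hc h₁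
  obtain ⟨b, hb⟩ := F.map_surjective (e'.hom ≫ i)
  -- Now `Ext¹(M, F Q) = 0` makes the morphism `b : N' ⟶ Q₀` over `i` an inflation; its cokernel is
  -- the object sought.
  obtain ⟨X, q, w', hc'⟩ := isInflation_of_extension hcog hobs b fun φ => by
    obtain ⟨ψ, hψ⟩ := TorsionFrob.exists_extension h₀ (F.obj Q) (e'.inv ≫ F.map φ)
    obtain ⟨ψ, rfl⟩ := F.map_surjective ψ
    refine ⟨ψ, F.map_injective ?_⟩
    have hψ : i ≫ F.map ψ = e'.inv ≫ F.map φ := hψ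
    rw [F.map_comp, hb, Category.assoc, hψ, e'.hom_inv_id_assoc]
  have wb : F.map b ≫ p₀ = 0 := by rw [hb, Category.assoc, w₀, comp_zero]
  let e₀ : ShortComplex.mk _ _ w₀ ≅ ShortComplex.mk _ _ wb :=
    ShortComplex.isoMk e'.symm (Iso.refl _) (Iso.refl _) (by simp [hb]) (by simp)
  have hb' := ShortComplex.shortExact_of_iso e₀ h₀
  obtain ⟨e'', -⟩ := h.exists_iso_of_inflation hc' hb'
  exact ⟨X, ⟨e''⟩⟩

/-- `F` is an exact equivalence onto the Gorenstein projective modules. -/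
theorem isExactEquivalence [HasFiniteBiproducts D] [HasKernels D] [IsNoetherianRing R]
    [c.IsClosedUnderIsomorphisms] :
    IsExactEquivalence c (confl (GP R)) ((GP R).lift F h.gp_obj) := by
  have := h.full
  have := h.faithful
  refine ⟨{ essSurj := ⟨fun M => ?_⟩ }, fun S => ⟨h.shortExact S,
    h.conflation_of_shortExact hcog hobs⟩⟩
  obtain ⟨X, ⟨e⟩⟩ := h.exists_iso_of_gp hcog hobs M.property
  exact ⟨X, ⟨(GP R).isoMk e⟩⟩

end IsProjInjGenerator

end Generator

end TorsionFrob

namespace TorsionFrob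

/-! ### The functors `Hom(Q, -)` and `Hom(-, Q)` -/

section HomFunctors

variable {D : Type u} [Category.{v} D] [Preadditive D] {c : ObjectProperty (ShortComplex D)} {Q : D}

/-- A linear map out of `Hom(Q, Q)` is determined by its value at `𝟙 Q`. Left exactness holds for
every kernel, and projectivity of `Q` supplies surjectivity on deflations. -/
lemma isProjInjGenerator_coyoneda (hc : IsExactStructure c) (hp : IsProj c Q) (hi : IsInj c Q)
    (hcov : ∀ X, ∃ (Q₀ : D) (p : Q₀ ⟶ X), IsSummand Q Q₀ ∧ IsDeflation c p) :
    IsProjInjGenerator c (preadditiveCoyonedaObj Q) Q := by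
  have hk : ∀ {K X Y : D} (k : K ⟶ X) (a : X ⟶ Y) (w : k ≫ a = 0),
      Nonempty (IsLimit (KernelFork.ofι k w)) →
        Mono ((preadditiveCoyonedaObj Q).map k) ∧
          ((ShortComplex.mk k a w).map (preadditiveCoyonedaObj Q)).Exact := by
    rintro K X Y k a w ⟨hl⟩
    have : Mono k := mono_of_isLimit_fork hl
    constructor
    · rw [ModuleCat.mono_iff_injective]
      exact fun x y hxy => (cancel_mono k).1 hxy
    · rw [ShortComplex.ShortExact.moduleCat_exact_iff_function_exact]
      intro x
      constructor
      · intro hx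
        obtain ⟨l, hl⟩ := KernelFork.IsLimit.lift' hl x hx
        exact ⟨l, hl⟩
      · rintro ⟨y, rfl⟩
        exact (Category.assoc (y : Q ⟶ K) k a).trans
          ((congrArg (fun z => (y : Q ⟶ K) ≫ z) w).trans comp_zero)
  refine ⟨⟨?_⟩, fun X => ⟨fun x y hxy => ?_, fun φ => ⟨φ.hom (𝟙 Q), ?_⟩⟩,
    fun S hS => (hc.kernel_cokernel S hS).2, fun S hS => ?_, hk, hi, hcov⟩
  · exact LinearEquiv.toModuleIso
      { toFun := fun x : Q ⟶ Q => (MulOpposite.op (x : End Q) : (End Q)ᵐᵒᵖ)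
        invFun := fun x => MulOpposite.unop x
        map_add' := fun _ _ => rfl
        map_smul' := fun _ _ => rfl
        left_inv := fun _ => rfl
        right_inv := fun _ => rfl }
  · have h := congrArg (fun f => f.hom (𝟙 Q)) hxy
    exact (Category.id_comp x).symm.trans (h.trans (Category.id_comp y))
  · refine ModuleCat.hom_ext (LinearMap.ext fun x : Q ⟶ Q => ?_)
    have h := φ.hom.map_smul (MulOpposite.op (x : End Q)) (𝟙 Q)
    exact h.symm.trans (congrArg φ.hom (Category.comp_id x))
  · obtain ⟨hm, hex⟩ := hk S.f S.g S.zero (hc.kernel_cokernel S hS).1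
    exact ShortComplex.ShortExact.mk' hex hm
      ((ModuleCat.epi_iff_surjective _).2 fun x => hp S hS x)

/-- Passing to the opposite category exchanges the roles: injectivity of `Q` gives exactness of the
functor, and projectivity of `Q` its injectivity as an object. -/
lemma isProjInjGenerator_yoneda (hc : IsExactStructure c) (hp : IsProj c Q) (hi : IsInj c Q)
    (hcog : ∀ X, ∃ (J : D) (j : X ⟶ J), IsSummand Q J ∧ IsInflation c j) :
    IsProjInjGenerator (fun S : ShortComplex Dᵒᵖ => c S.unop) (preadditiveYonedaObj Q)
      (Opposite.op Q) := by
  have hk : ∀ {K X Y : Dᵒᵖ} (k : K ⟶ X) (a : X ⟶ Y) (w : k ≫ a = 0),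
      Nonempty (IsLimit (KernelFork.ofι k w)) →
        Mono ((preadditiveYonedaObj Q).map k) ∧
          ((ShortComplex.mk k a w).map (preadditiveYonedaObj Q)).Exact := by
    rintro K X Y k a w ⟨hl⟩
    have : Mono k := mono_of_isLimit_fork hl
    constructor
    · rw [ModuleCat.mono_iff_injective]
      exact fun x y hxy => (cancel_epi k.unop).1 hxy
    · rw [ShortComplex.ShortExact.moduleCat_exact_iff_function_exact]
      intro x
      constructor
      · intro hx
        have hx : a.unop ≫ (x : X.unop ⟶ Q) = 0 := hx
        obtain ⟨l, hl⟩ := KernelFork.IsLimit.lift' hl (x : X.unop ⟶ Q).op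
          (congrArg Quiver.Hom.op hx)
        exact ⟨l.unop, congrArg Quiver.Hom.unop hl⟩
      · rintro ⟨y, rfl⟩
        exact (Category.assoc a.unop k.unop (y : K.unop ⟶ Q)).symm.trans
          ((congrArg (fun z => z.unop ≫ (y : K.unop ⟶ Q)) w).trans zero_comp)
  refine ⟨⟨?_⟩, fun X => ⟨fun x y hxy => ?_, fun φ => ⟨(φ.hom (𝟙 Q) : X.unop ⟶ Q).op, ?_⟩⟩,
    fun S hS => ?_, fun S hS => ?_, hk, fun S hS f => ?_, fun X => ?_⟩
  · exact LinearEquiv.toModuleIso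
      { toFun := fun x : Q ⟶ Q => (x : End Q)
        invFun := fun x => x
        map_add' := fun _ _ => rfl
        map_smul' := fun _ _ => rfl
        left_inv := fun _ => rfl
        right_inv := fun _ => rfl }
  · have h := congrArg (fun f => f.hom (𝟙 Q)) hxy
    exact Quiver.Hom.unop_inj ((Category.comp_id x.unop).symm.trans
      (h.trans (Category.comp_id y.unop)))
  · refine ModuleCat.hom_ext (LinearMap.ext fun x : Q ⟶ Q => ?_)
    have h := φ.hom.map_smul (x : End Q) (𝟙 Q)
    exact h.symm.trans (congrArg φ.hom (Category.id_comp x))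
  · obtain ⟨hl⟩ := (hc.kernel_cokernel _ hS).1
    exact ⟨KernelFork.IsLimit.ofιOp _ _ hl⟩
  · obtain ⟨hl⟩ := (hc.kernel_cokernel _ hS).2
    obtain ⟨hm, hex⟩ := hk S.f S.g S.zero ⟨CokernelCofork.IsColimit.ofπOp _ _ hl⟩
    exact ShortComplex.ShortExact.mk' hex hm
      ((ModuleCat.epi_iff_surjective _).2 fun x => hi _ hS x)
  · obtain ⟨b, hb⟩ := hp _ hS f.unop
    exact ⟨b.op, congrArg Quiver.Hom.op hb⟩
  · obtain ⟨J, j, hJ, Z, p, w, h⟩ := hcog X.unop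
    exact ⟨Opposite.op J, j.op, hJ.op, Opposite.op Z, p.op, congrArg Quiver.Hom.op w, h⟩

end HomFunctors

/-! ### From Frobenius categories to Iwanaga-Gorenstein rings -/

section Frobenius

variable {D : Type u} [Category.{v} D] [Preadditive D] [HasFiniteBiproducts D] [HasKernels D]
  [HasCokernels D] {c : ObjectProperty (ShortComplex D)} {Q : D}

/-- A preabelian Frobenius category with projective generator `Q` is the category of Gorenstein
projective modules over the endomorphism ring of `Q`. -/
theorem gorenstein_of_isFrobenius (hc : IsFrobenius c) (hQ : ∀ X, IsProj c X ↔ IsSummand Q X)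
    (hobs : ∀ {X Y Z : D} (i : X ⟶ Y) (j : Y ⟶ Z), IsInflation c (i ≫ j) → IsInflation c i)
    (hR : IsTwoSidedNoetherian (End Q)) :
    (∃ h : ∀ X, GP (End Q)ᵐᵒᵖ ((preadditiveCoyonedaObj Q).obj X),
      IsExactEquivalence c (confl (GP (End Q)ᵐᵒᵖ))
        ((GP (End Q)ᵐᵒᵖ).lift (preadditiveCoyonedaObj Q) h)) ∧
    IsIwanagaGorenstein (End Q) ∧ VirDimLE (End Q) 2 := by
  obtain ⟨hc, hp, hi, hpi⟩ := hc
  have := hR.1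
  have := hR.2
  have := hc.iso_closed
  have : HasKernels Dᵒᵖ := ⟨fun f => HasLimit.mk
    ⟨_, CokernelCofork.IsColimit.ofπOp _ (cokernel.condition f.unop) (cokernelIsCokernel f.unop)⟩⟩
  have : HasFiniteBiproducts Dᵒᵖ := HasFiniteBiproducts.of_hasFiniteProducts
  have hQp := (hQ Q).2 (isSummand_self Q)
  have hcov : ∀ X, ∃ (Q₀ : D) (p : Q₀ ⟶ X), IsSummand Q Q₀ ∧ IsDeflation c p := fun X => by
    obtain ⟨P, p, hP, h⟩ := hp X
    exact ⟨P, p, (hQ P).1 hP, h⟩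
  have hcog : ∀ X, ∃ (J : D) (j : X ⟶ J), IsSummand Q J ∧ IsInflation c j := fun X => by
    obtain ⟨I, i, hI, h⟩ := hi X
    exact ⟨I, i, (hQ I).1 ((hpi I).2 hI), h⟩
  have h₁ := isProjInjGenerator_coyoneda hc hQp ((hpi Q).1 hQp) hcov
  have h₂ := isProjInjGenerator_yoneda hc hQp ((hpi Q).1 hQp) hcog
  -- `Hom(-, Q)` takes values in modules over `End Q`, and `Hom(Q, -)` in modules over the opposite
  -- ring, so the two functors bound the two injective dimensions.
  have hv : VirDimLE (End Q) 2 :=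
    ⟨h₂.hasInjectiveDimensionLE_two, h₁.hasInjectiveDimensionLE_two⟩
  exact ⟨⟨h₁.gp_obj, h₁.isExactEquivalence hcog hobs⟩, ⟨hR, ⟨2, hv.1⟩, ⟨2, hv.2⟩⟩, hv⟩

end Frobenius

/-! ### Application to `C₁₂` -/

section Core

variable {A : Type u} [Category.{v} A] [Abelian A]

/-- The obscure axiom of exact categories, for extension-closed subcategories that are closed
under direct summands. -/
lemma isInflation_of_isInflation_comp (P : ObjectProperty A) [P.IsClosedUnderIsomorphisms]
    [P.IsClosedUnderExtensions] (hP : ∀ {X Y : A}, P Y → Retract X Y → P X)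
    {X Y Z : P.FullSubcategory} (i : X ⟶ Y) (j : Y ⟶ Z) (h : IsInflation (confl P) (i ≫ j)) :
    IsInflation (confl P) i := by
  rw [isInflation_iff] at h
  obtain ⟨hm, hc⟩ := h
  have hm' : Mono (i.hom ≫ j.hom) := hm
  have : Mono i.hom := mono_of_mono i.hom j.hom
  let g : X.obj ⟶ Z.obj := i.hom ≫ j.hom
  have : Mono g := hm'
  have sq := IsPushout.of_hasPushout g i.hom
  have hc' : P (cokernel (pushout.inr g i.hom)) := by
    have := isIso_cokernel_map_of_isPushout sq
    exact P.prop_of_iso (asIso (cokernel.map _ _ _ _ sq.w)) hc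
  have hE : P (pushout g i.hom) :=
    P.prop_X₂_of_shortExact (ShortComplex.ShortExact.mk'
      (ShortComplex.exact_cokernel (pushout.inr g i.hom)) inferInstance
      (inferInstanceAs (Epi (cokernel.π _)))) Y.property hc'
  refine isInflation_of_cokernel P i (hP hE ?_)
  -- The pushout `E` of `i ≫ j` along `i` is an extension of objects of `P`. The map `inr - j ≫ inl`
  -- vanishes on `X`, so it induces a section of the projection from `E` to the cokernel of `i`.
  refine ⟨cokernel.desc i.hom (pushout.inr g i.hom - j.hom ≫ pushout.inl g i.hom) ?_,
    pushout.desc 0 (cokernel.π i.hom) ?_, ?_⟩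
  · rw [Preadditive.comp_sub, ← Category.assoc, ← pushout.condition, sub_self]
  · rw [comp_zero, cokernel.condition]
  · rw [← cancel_epi (cokernel.π i.hom)]
    rw [cokernel.π_desc_assoc, Preadditive.sub_comp, pushout.inr_desc, Category.assoc,
      pushout.inl_desc, Category.comp_id]
    exact (congrArg _ comp_zero).trans (sub_zero _)

variable (τ₁ τ₂ : TorsionPair A)

lemma isProj_core_iff_isSummand (h : HasEnoughProj (confl τ₁.tors)) {P : τ₁.tors.FullSubcategory}
    (hP : ∀ X, IsProj (confl τ₁.tors) X ↔ addClosure P X) (X : (core τ₁ τ₂).FullSubcategory) :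
    IsProj (confl (core τ₁ τ₂)) X ↔ IsSummand ((fCore τ₁ τ₂).obj P) X := by
  constructor
  · intro hX
    obtain ⟨P', hP', ⟨r⟩⟩ := (isProj_iff_retract (fCore τ₁ τ₂).obj _
      (fun _ => isProj_fCore τ₁ τ₂) (exists_deflation_fCore τ₁ τ₂ h) X).1 hX
    exact ((IsSummand.of_addClosure ((hP P').1 hP')).map (fCore τ₁ τ₂)).of_retract r
  · intro hX
    exact hX.isProj (isProj_fCore τ₁ τ₂ ((hP P).2 (addClosure_self P)))

lemma isInj_core_iff_isSummand (h : HasEnoughInj (confl τ₂.free)) {I : τ₂.free.FullSubcategory}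
    (hI : ∀ X, IsInj (confl τ₂.free) X ↔ addClosure I X) (X : (core τ₁ τ₂).FullSubcategory) :
    IsInj (confl (core τ₁ τ₂)) X ↔ IsSummand ((tCore τ₁ τ₂).obj I) X := by
  constructor
  · intro hX
    obtain ⟨I', hI', ⟨r⟩⟩ := (isInj_iff_retract (tCore τ₁ τ₂).obj _
      (fun _ => isInj_tCore τ₁ τ₂) (exists_inflation_tCore τ₁ τ₂ h) X).1 hX
    exact ((IsSummand.of_addClosure ((hI I').1 hI')).map (tCore τ₁ τ₂)).of_retract r
  · intro hX
    exact hX.isInj (isInj_tCore τ₁ τ₂ ((hI I).2 (addClosure_self I)))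

end Core

end TorsionFrob

theorem propositionP {A : Type u} [Category.{v} A] [Abelian A] (τ₁ τ₂ : TorsionPair A) :
    -- (a)
    (core τ₁ τ₂).IsClosedUnderExtensions ∧
    IsIdempotentComplete (core τ₁ τ₂).FullSubcategory ∧
    IsExactStructure (confl (core τ₁ τ₂)) ∧
    -- (b)
    HasFiniteBiproducts (core τ₁ τ₂).FullSubcategory ∧
    HasKernels (core τ₁ τ₂).FullSubcategory ∧
    HasCokernels (core τ₁ τ₂).FullSubcategory ∧
    (∀ {X Y : (core τ₁ τ₂).FullSubcategory} (a : X ⟶ Y),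
      (∃ (hK : core τ₁ τ₂ (τ₁.t (kernel a.hom)))
        (w : (ObjectProperty.homMk (τ₁.incl (kernel a.hom) ≫ kernel.ι a.hom) :
          (⟨_, hK⟩ : (core τ₁ τ₂).FullSubcategory) ⟶ X) ≫ a = 0),
        Nonempty (IsLimit (KernelFork.ofι _ w))) ∧
      ∃ (hQ : core τ₁ τ₂ (τ₂.f (cokernel a.hom)))
        (w : a ≫ (ObjectProperty.homMk (cokernel.π a.hom ≫ τ₂.proj (cokernel a.hom)) :
          Y ⟶ (⟨_, hQ⟩ : (core τ₁ τ₂).FullSubcategory)) = 0),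
        Nonempty (IsColimit (CokernelCofork.ofπ _ w))) ∧
    IsAbelianOfGlobalDimLE (ModCat (core τ₁ τ₂).FullSubcategory) 2 ∧
    IsAbelianOfGlobalDimLE (ModCat (core τ₁ τ₂).FullSubcategoryᵒᵖ) 2 ∧
    -- (c), (d), (e)
    (HasEnoughProj (confl τ₁.tors) → HasEnoughInj (confl τ₂.free) →
      -- (c)
      (∀ X, IsProj (confl (core τ₁ τ₂)) X ↔
        ∃ P, IsProj (confl τ₁.tors) P ∧ Nonempty (Retract X ((fCore τ₁ τ₂).obj P))) ∧
      (∀ X, ∃ (P : τ₁.tors.FullSubcategory) (p : (fCore τ₁ τ₂).obj P ⟶ X),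
        IsProj (confl τ₁.tors) P ∧ IsDeflation (confl (core τ₁ τ₂)) p) ∧
      HasEnoughProj (confl (core τ₁ τ₂)) ∧
      (∀ X, IsInj (confl (core τ₁ τ₂)) X ↔
        ∃ I, IsInj (confl τ₂.free) I ∧ Nonempty (Retract X ((tCore τ₁ τ₂).obj I))) ∧
      (∀ X, ∃ (I : τ₂.free.FullSubcategory) (i : X ⟶ (tCore τ₁ τ₂).obj I),
        IsInj (confl τ₂.free) I ∧ IsInflation (confl (core τ₁ τ₂)) i) ∧
      HasEnoughInj (confl (core τ₁ τ₂)) ∧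
      (ExtOneSymmetric (confl (core τ₁ τ₂)) →
        -- (d)
        IsFrobenius (confl (core τ₁ τ₂)) ∧
        -- (e)
        ∀ (P : τ₁.tors.FullSubcategory) (I : τ₂.free.FullSubcategory),
          (∀ X, IsProj (confl τ₁.tors) X ↔ addClosure P X) →
          (∀ X, IsInj (confl τ₂.free) X ↔ addClosure I X) →
          (∀ X, IsProj (confl (core τ₁ τ₂)) X ↔ addClosure ((fCore τ₁ τ₂).obj P) X) ∧
          (∀ X, IsProj (confl (core τ₁ τ₂)) X ↔ addClosure ((tCore τ₁ τ₂).obj I) X) ∧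
          (IsTwoSidedNoetherian (End ((fCore τ₁ τ₂).obj P)) →
            (∃ h : ∀ X, GP (End ((fCore τ₁ τ₂).obj P))ᵐᵒᵖ
                ((preadditiveCoyonedaObj ((fCore τ₁ τ₂).obj P)).obj X),
              IsExactEquivalence (confl (core τ₁ τ₂))
                (confl (GP (End ((fCore τ₁ τ₂).obj P))ᵐᵒᵖ))
                ((GP (End ((fCore τ₁ τ₂).obj P))ᵐᵒᵖ).lift
                  (preadditiveCoyonedaObj ((fCore τ₁ τ₂).obj P)) h)) ∧
            IsIwanagaGorenstein (End ((fCore τ₁ τ₂).obj P)) ∧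
            VirDimLE (End ((fCore τ₁ τ₂).obj P)) 2))) ∧
    -- (d), sufficient conditions for the symmetry of the vanishing of `Ext¹`
    (∀ (k : Type w) [Field k] [Linear k A],
      (∀ [HasDerivedCategory.{w'} A], DerivedIsTwoCalabiYau k A →
        ExtOneSymmetric (confl (core τ₁ τ₂))) ∧
      (∀ [EnoughInjectives A], StableIsTwoCalabiYau A k →
        ExtOneSymmetric (confl (core τ₁ τ₂)))) ∧
    -- (f)
    (∀ (P : τ₁.tors.FullSubcategory) (I : τ₂.free.FullSubcategory),
      (∀ X, IsProj (confl τ₁.tors) X ↔ addClosure P X) →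
      (∀ X, IsInj (confl τ₂.free) X ↔ addClosure I X) →
      (∀ a : End P, endRingHom (fCore τ₁ τ₂) P a = 0 ↔
        ∃ (x : P.obj ⟶ τ₂.t P.obj) (y : τ₂.t P.obj ⟶ P.obj), a.hom = x ≫ y) ∧
      (∀ a : End I, endRingHom (tCore τ₁ τ₂) I a = 0 ↔
        ∃ (x : I.obj ⟶ τ₁.f I.obj) (y : τ₁.f I.obj ⟶ I.obj), a.hom = x ≫ y) ∧
      (τ₂.tors ≤ τ₁.tors →
        Function.Surjective (endRingHom (fCore τ₁ τ₂) P) ∧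
        Function.Surjective (endRingHom (tCore τ₁ τ₂) I)) ∧
      -- an isomorphism of `t₁ I` with `f₂ P` makes `Π₁₂` the target of both ring homomorphisms
      (∀ θ : (tCore τ₁ τ₂).obj I ≅ (fCore τ₁ τ₂).obj P,
        (∀ a : End I, (endConj θ).comp (endRingHom (tCore τ₁ τ₂) I) a = 0 ↔
          ∃ (x : I.obj ⟶ τ₁.f I.obj) (y : τ₁.f I.obj ⟶ I.obj), a.hom = x ≫ y) ∧
        (τ₂.tors ≤ τ₁.tors →
          Function.Surjective ((endConj θ).comp (endRingHom (tCore τ₁ τ₂) I))))) := by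
  have hex : IsExactStructure (confl (core τ₁ τ₂)) := isExactStructure_confl _
  refine ⟨inferInstance, isIdempotentComplete_core τ₁ τ₂, hex, inferInstance, inferInstance,
    inferInstance, fun a => ⟨core_kernel τ₁ τ₂ a, core_cokernel τ₁ τ₂ a⟩,
    isAbelianOfGlobalDimLE_modCat_core τ₁ τ₂, isAbelianOfGlobalDimLE_modCat_core_op τ₁ τ₂,
    fun hp hi => ?_, fun k _ _ => ⟨fun h => extOneSymmetric_of_derivedIsTwoCalabiYau h _,
      fun h => extOneSymmetric_of_stableIsTwoCalabiYau h _⟩, fun P I hP hI => ?_⟩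
  · have hfp := exists_deflation_fCore τ₁ τ₂ hp
    have hti := exists_inflation_tCore τ₁ τ₂ hi
    have hp' : HasEnoughProj (confl (core τ₁ τ₂)) := fun X => by
      obtain ⟨P, p, hP, h⟩ := hfp X
      exact ⟨_, p, isProj_fCore τ₁ τ₂ hP, h⟩
    have hi' : HasEnoughInj (confl (core τ₁ τ₂)) := fun X => by
      obtain ⟨I, i, hI, h⟩ := hti X
      exact ⟨_, i, isInj_tCore τ₁ τ₂ hI, h⟩
    refine ⟨isProj_iff_retract _ _ (fun _ => isProj_fCore τ₁ τ₂) hfp, hfp, hp',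
      isInj_iff_retract _ _ (fun _ => isInj_tCore τ₁ τ₂) hti, hti, hi', fun hs => ?_⟩
    have hF := isFrobenius_of_extOneSymmetric hex hp' hi' hs
    refine ⟨hF, fun P I hP hI => ?_⟩
    have hP' := isProj_core_iff_isSummand τ₁ τ₂ hp hP
    refine ⟨fun X => (hP' X).trans (addClosure_iff_isSummand _ _).symm, fun X =>
      -- The Frobenius property turns the description of the injectives by `t₁ I` into one of the
      -- projectives.
      (hF.2.2.2 X).trans ((isInj_core_iff_isSummand τ₁ τ₂ hi hI X).trans
        (addClosure_iff_isSummand _ _).symm),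
      gorenstein_of_isFrobenius hF hP'
        (isInflation_of_isInflation_comp (core τ₁ τ₂) core_of_retract)⟩
  · have hP' := (hP P).2 (addClosure_self P)
    have hI' := (hI I).2 (addClosure_self I)
    refine ⟨endRingHom_fCore_eq_zero_iff τ₁ τ₂ P, endRingHom_tCore_eq_zero_iff τ₁ τ₂ I,
      fun h => ⟨endRingHom_fCore_surjective τ₁ τ₂ h hP', endRingHom_tCore_surjective τ₁ τ₂ h hI'⟩,
      fun θ => ⟨fun a => ?_, fun h => ?_⟩⟩
    · exact (endConj_injective θ _).trans (endRingHom_tCore_eq_zero_iff τ₁ τ₂ I a)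
    · exact (endConj_surjective θ).comp (endRingHom_tCore_surjective τ₁ τ₂ h hI')
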